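/- **Weak convergence for the Curie–Weiss–Potts model.** Let $q>2$ be an integer, $\Lambda=\{\theta^1,\dots,\theta^q\}$ a set of $q$ letters, $\Sigma_q=\Lambda^{\mathbb N}$ with the product topology, $\sigma$ the shift map on $\Sigma_q$, $\rho$ the uniform probability on $\Lambda$ and $\mathbb P=\rho^{\otimes\mathbb N}$. For a word $\omega=\omega_0\cdots\omega_{n-1}$ put $$H_n(\omega)=-\frac1{2n}\sum_{i,j=0}^{n-1}\mathbf 1_{\omega_j=\omega_i},$$ and let $\mu_{n,\beta}$ be the probability measure on $\Sigma_q$ given by $$\mu_{n,\beta}(d\omega)=\frac{e^{-\beta H_n(\omega_0\cdots\omega_{n-1})}}{Z_{n,\beta}}\,\mathbb P(d\omega),\qquad Z_{n,\beta}=\frac1{q^n}\sum_{|\omega'|=n}e^{-\beta H_n(\omega')}.$$ For $1\le k\le q$ and $b\in\mathbb R$ let $\widetilde\mu^k_b$ be the dynamical Gibbs measure for $b\,\mathbf 1_{[\theta^k]}$, that is, the unique equilibrium state: the unique $\sigma$-invariant probability measure $\mu$ on $\Sigma_q$ which maximizes $h_\mu+b\,\mu([\theta^k])$, where $h_\mu$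 is the Kolmogorov–Sinai entropy of $\mu$ and $[\theta^k]=\{x\in\Sigma_q: x_0=\theta^k\}$ (it exists and is unique). Let $$\beta_c=\frac{2(q-1)\log(q-1)}{q-2}.$$ For $0<\beta<\beta_c$ set $s_\beta=0$, and for $\beta\ge\beta_c$ let $s_\beta$ be the largest real solution (which exists) of $$s=\frac{e^{\beta s}-1}{e^{\beta s}+q-1}.$$ Then, as $n\to+\infty$, the measures $\mu_{n,\beta}$ converge weakly to $$\begin{cases}\rho^{\otimes\mathbb N}&\text{if }0<\beta<\beta_c,\\[4pt] \dfrac1q\displaystyle\sum_{k=1}^q\widetilde\mu^k_{\beta s_\beta}&\text{if }\beta>\beta_c,\\[8pt] \dfrac{A\,\widetilde\mu^1_0+B\displaystyle\sum_{k=1}^q\widetilde\mu^k_{\beta_c s_{\beta_c}}}{A+qB}&\text{if }\beta=\beta_c,\end{cases}$$ where $A=\left(1-\frac{\beta_c}{q(q-1)}\right)^{\frac{q-2}2}$ and $B=\left(1-\frac{\beta_c}{q}\right)^{\frac{q-2}2}$. -/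

import Mathlib

open MeasureTheory Filter Topology
open scoped ENNReal

noncomputable section

namespace CWP

/-! ### Entropy, pressure and equilibrium states of a measurable dynamical system -/

/-- Shannon entropy `-∑ μ(Cᵢ) log μ(Cᵢ)` of the finite partition of `X` into the level sets
`Cᵢ = {f = i}` of a labelling `f`. -/
def partitionEntropy {X ι : Type*} [MeasurableSpace X] [Fintype ι]
    (μ : Measure X) (f : X → ι) : ℝ :=
  ∑ i, Real.negMulLog (μ.real (f ⁻¹' {i}))

/-- The labelling of the joint partition `⋁_{j<n} T^{-j} ξ`, where `ξ` is the partition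
labelled by `f`. -/
def itinerary {X ι : Type*} (T : X → X) (f : X → ι) (n : ℕ) : X → (Fin n → ι) :=
  fun x j => f (T^[j] x)

/-- Entropy `h_μ(T, ξ) = lim (1/n) H_μ(⋁_{j<n} T^{-j} ξ)` of `T` relative to a finite partition.
For `T`-invariant `μ` the sequence converges by subadditivity, so the upper limit is the limit. -/
def entropyRate {X ι : Type*} [MeasurableSpace X] [Fintype ι]
    (μ : Measure X) (T : X → X) (f : X → ι) : ℝ≥0∞ :=
  limsup (fun n : ℕ => ENNReal.ofReal (partitionEntropy μ (itinerary T f n) / n)) atTop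

/-- Kolmogorov–Sinai entropy: the supremum of the entropies relative to all finite measurable
partitions. -/
def ksEntropy {X : Type*} [MeasurableSpace X] (μ : Measure X) (T : X → X) : ℝ≥0∞ :=
  ⨆ (m : ℕ) (f : X → Fin m) (_ : Measurable f), entropyRate μ T f

/-- Free energy `h_μ + ∫ ψ dμ`. -/
def freeEnergy {X : Type*} [MeasurableSpace X] (T : X → X) (ψ : X → ℝ) (μ : Measure X) : EReal :=
  (ksEntropy μ T : EReal) + ((∫ x, ψ x ∂μ : ℝ) : EReal)

/-- `T`-invariant probability measures. -/
def IsInvariantProb {X : Type*} [MeasurableSpace X] (T : X → X) (μ : Measure X) : Prop :=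
  IsProbabilityMeasure μ ∧ MeasurePreserving T μ μ

/-- Pressure: the supremum of the free energy over the invariant probability measures. -/
def pressure {X : Type*} [MeasurableSpace X] (T : X → X) (ψ : X → ℝ) : EReal :=
  ⨆ (μ : Measure X) (_ : IsInvariantProb T μ), freeEnergy T ψ μ

/-- Equilibrium states: invariant probability measures at which the pressure is attained. -/
def IsEquilibriumState {X : Type*} [MeasurableSpace X] (T : X → X) (ψ : X → ℝ)
    (μ : Measure X) : Prop :=
  IsInvariantProb T μ ∧ freeEnergy T ψ μ = pressure T ψ

/-- `μ` is the dynamical Gibbs measure of `ψ`: the unique equilibrium state. -/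
def IsDynamicalGibbs {X : Type*} [MeasurableSpace X] (T : X → X) (ψ : X → ℝ)
    (μ : Measure X) : Prop :=
  IsEquilibriumState T ψ μ ∧ ∀ ν : Measure X, IsEquilibriumState T ψ ν → ν = μ

/-- Weak convergence of a sequence of Borel probability measures. -/
def WeaklyConverges {X : Type*} [TopologicalSpace X] [MeasurableSpace X] [OpensMeasurableSpace X]
    (P : ℕ → Measure X) (Q : Measure X) : Prop :=
  ∃ (P' : ℕ → ProbabilityMeasure X) (Q' : ProbabilityMeasure X),
    (∀ n, (P' n : Measure X) = P n) ∧ (Q' : Measure X) = Q ∧ Tendsto P' atTop (𝓝 Q')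

/-! ### The full shift and the Curie–Weiss–Potts model -/

/-- One-sided full shift space over an alphabet of `q` letters (product topology and product
σ-algebra). -/
abbrev Shift (q : ℕ) : Type := ℕ → Fin q

/-- The shift map. -/
def shift {q : ℕ} (x : Shift q) : Shift q := fun n => x (n + 1)

/-- The potential `b · 1_{[θ^k]}`. -/
def potential {q : ℕ} (k : Fin q) (b : ℝ) : Shift q → ℝ :=
  fun x => if x 0 = k then b else 0

/-- Curie–Weiss–Potts Hamiltonian of a word of length `n`. -/
def hamiltonian {q n : ℕ} (w : Fin n → Fin q) : ℝ :=
  -(1 / (2 * (n : ℝ))) * ∑ i, ∑ j, if w j = w i then (1 : ℝ) else 0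

/-- The uniform Bernoulli measure `ρ^{⊗ℕ}`. -/
def uniformBernoulli (q : ℕ) : Measure (Shift q) :=
  Measure.infinitePi fun _ : ℕ => ProbabilityTheory.uniformOn (Set.univ : Set (Fin q))

/-- Normalization factor `Z_{n,β}`. -/
def partitionFunction (q n : ℕ) (β : ℝ) : ℝ :=
  (1 / (q : ℝ) ^ n) * ∑ w : Fin n → Fin q, Real.exp (-β * hamiltonian w)

/-- The probabilistic Gibbs measure `μ_{n,β}`. -/
def gibbs (q n : ℕ) (β : ℝ) : Measure (Shift q) :=
  (uniformBernoulli q).withDensity fun x =>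
    ENNReal.ofReal
      (Real.exp (-β * hamiltonian (fun i : Fin n => x i)) / partitionFunction q n β)

/-- The critical inverse temperature `β_c`. -/
def betaC (q : ℕ) : ℝ := 2 * ((q : ℝ) - 1) * Real.log ((q : ℝ) - 1) / ((q : ℝ) - 2)

/-- Real solutions of `s = (e^{βs} - 1) / (e^{βs} + q - 1)`. -/
def meanFieldRoots (q : ℕ) (β : ℝ) : Set ℝ :=
  {s | s = (Real.exp (β * s) - 1) / (Real.exp (β * s) + (q : ℝ) - 1)}

/-- `s_β`: zero below `β_c`, and the largest root from `β_c` on. -/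
def sBeta (q : ℕ) (β : ℝ) : ℝ :=
  if β < betaC q then 0 else sSup (meanFieldRoots q β)

/-- The weight `A`. -/
def weightA (q : ℕ) : ℝ := (1 - betaC q / ((q : ℝ) * ((q : ℝ) - 1))) ^ (((q : ℝ) - 2) / 2)

/-- The weight `B`. -/
def weightB (q : ℕ) : ℝ := (1 - betaC q / (q : ℝ)) ^ (((q : ℝ) - 2) / 2)

end CWP

end

/-!
The entropy of an invariant measure is at most that of its one-letter marginal, with equality only
for product measures. By Gibbs' inequality the equilibrium state of a potential that depends on the
first letter is therefore the Bernoulli measure whose letter weights are its softmax.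

Since `-n H_n(ω)` is half the sum of the squared letter counts of `ω`, a Gaussian integral over a
field `y ∈ ℝ^q` linearizes it (Hubbard–Stratonovich): the law of a prefix of fixed length is a
mixture of product laws with letter weights `softmax (β y)`, in which `y` has a density proportional
to `exp (-n F(y))`, with `F(y) = β |y|² / 2 - log ∑ᵢ exp (β yᵢ)`. By Laplace's method `y`
concentrates on the minimizers of `F`, with weights proportional to `1 / √(det Hess F)`.

A minimizer satisfies `y = softmax (β y)`, so any two distinct coordinates have logarithmic mean
`1 / β`; with the second-order condition this leaves only the points at which all coordinates but
the largest one agree. In terms of the magnetization `s` of such a point, `F` is an increasing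
affine function of `β s² / 2 - K(β s)`, where `K' = M` and `M(x) = (eˣ - 1) / (eˣ + q - 1)`. The
graph of `M` is symmetric about its inflection point `log (q - 1)`; hence `K(x) ≤ x² / (2 β_c)`
(the Kearns–Saul inequality), with equality exactly at `x = 0` and `x = 2 log (q - 1)`. So the two
phases coexist at `β_c`, and convexity of `M` before the inflection point and concavity after it
single out the minimizer on either side.
-/

noncomputable section

namespace CWP

/-! ### Entropy of finite partitions -/

section GibbsInequality

open InformationTheory

variable {ι : Type*} [Fintype ι] {p Q : ι → ℝ}

lemma negMulLog_eq_sub_klFun {x y : ℝ} (h : y = 0 → x = 0) :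
    Real.negMulLog x = x * -Real.log y + (y - x) - y * klFun (x / y) := by
  rcases eq_or_ne y 0 with rfl | hy
  · simp [h rfl]
  rcases eq_or_ne x 0 with rfl | hx
  · simp [klFun]
  · rw [klFun_apply, Real.log_div hx hy, Real.negMulLog]
    field_simp
    ring

lemma sum_negMulLog_eq_sub_klFun (hpQ : ∀ i, Q i = 0 → p i = 0) :
    ∑ i, Real.negMulLog (p i) =
      ∑ i, p i * -Real.log (Q i) + (∑ i, Q i - ∑ i, p i) - ∑ i, Q i * klFun (p i / Q i) := by
  simp only [← Finset.sum_sub_distrib, ← Finset.sum_add_distrib]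
  exact Finset.sum_congr rfl fun i _ => negMulLog_eq_sub_klFun (hpQ i)

lemma sum_negMulLog_le (hp : ∀ i, 0 ≤ p i) (hQ : ∀ i, 0 ≤ Q i) (hpQ : ∀ i, Q i = 0 → p i = 0)
    (hsum : ∑ i, Q i ≤ ∑ i, p i) :
    ∑ i, Real.negMulLog (p i) ≤ ∑ i, p i * -Real.log (Q i) := by
  have hkl : 0 ≤ ∑ i, Q i * klFun (p i / Q i) := Finset.sum_nonneg fun i _ =>
    mul_nonneg (hQ i) (klFun_nonneg (div_nonneg (hp i) (hQ i)))
  rw [sum_negMulLog_eq_sub_klFun hpQ]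
  linarith

lemma eq_of_le_sum_negMulLog (hp : ∀ i, 0 ≤ p i) (hQ : ∀ i, 0 < Q i)
    (hsum : ∑ i, Q i ≤ ∑ i, p i)
    (h : ∑ i, p i * -Real.log (Q i) ≤ ∑ i, Real.negMulLog (p i)) : p = Q := by
  have hratio : ∀ i, 0 ≤ p i / Q i := fun i => div_nonneg (hp i) (hQ i).le
  have hkl : ∀ i ∈ Finset.univ, 0 ≤ Q i * klFun (p i / Q i) := fun i _ =>
    mul_nonneg (hQ i).le (klFun_nonneg (hratio i))
  have hzero : ∑ i, Q i * klFun (p i / Q i) = 0 := by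
    rw [sum_negMulLog_eq_sub_klFun fun i h0 => absurd h0 (hQ i).ne'] at h
    exact le_antisymm (by linarith) (Finset.sum_nonneg hkl)
  funext i
  have hi : klFun (p i / Q i) = 0 := (mul_eq_zero.1
    ((Finset.sum_eq_zero_iff_of_nonneg hkl).1 hzero i (Finset.mem_univ i))).resolve_left (hQ i).ne'
  rwa [klFun_eq_zero_iff (hratio i), div_eq_one_iff_eq (hQ i).ne'] at hi

end GibbsInequality

section PartitionEntropy

variable {X ι κ : Type*} [MeasurableSpace X]
  [Fintype ι] [MeasurableSpace ι] [MeasurableSingletonClass ι]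
  [Fintype κ] [MeasurableSpace κ] [MeasurableSingletonClass κ]
  {μ : Measure X} {f : X → ι} {g : X → κ}

lemma integral_comp_label [IsFiniteMeasure μ] (hf : Measurable f) (c : ι → ℝ) :
    ∫ x, c (f x) ∂μ = ∑ i, μ.real (f ⁻¹' {i}) * c i := by
  rw [← integral_map (φ := f) hf.aemeasurable (measurable_of_finite c).aestronglyMeasurable,
    integral_fintype Integrable.of_finite]
  exact Finset.sum_congr rfl fun i _ => by
    rw [map_measureReal_apply hf (measurableSet_singleton i), smul_eq_mul]

lemma integrable_comp_label {ι : Type*} [Finite ι] [MeasurableSpace ι]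
    [MeasurableSingletonClass ι] {f : X → ι} [IsFiniteMeasure μ] (hf : Measurable f) (c : ι → ℝ) :
    Integrable (fun x => c (f x)) μ :=
  (integrable_map_measure (measurable_of_finite c).aestronglyMeasurable hf.aemeasurable).1
    Integrable.of_finite

lemma ae_measureReal_label_pos {ι : Type*} [Finite ι] (μ : Measure X) [IsFiniteMeasure μ]
    (f : X → ι) : ∀ᵐ x ∂μ, 0 < μ.real (f ⁻¹' {f x}) := by
  have hnull : {x | ¬0 < μ.real (f ⁻¹' {f x})} = ⋃ i ∈ {i | μ.real (f ⁻¹' {i}) = 0}, f ⁻¹' {i} := by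
    ext x
    simp only [not_lt, Set.mem_ofPred_eq, Set.mem_iUnion, Set.mem_preimage, Set.mem_singleton_iff,
      exists_prop, exists_eq_right']
    exact ⟨fun h => h.antisymm measureReal_nonneg, le_of_eq⟩
  rw [ae_iff, hnull, measure_biUnion_null_iff (Set.to_countable _)]
  exact fun i hi => (measureReal_eq_zero_iff).1 hi

lemma partitionEntropy_comp_measurePreserving {T : X → X} (hT : MeasurePreserving T μ μ)
    (hf : Measurable f) : partitionEntropy μ (f ∘ T) = partitionEntropy μ f :=
  Finset.sum_congr rfl fun i _ => congrArg Real.negMulLog <|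
    hT.measureReal_preimage (hf (measurableSet_singleton i)).nullMeasurableSet

lemma partitionEntropy_eq_integral [IsFiniteMeasure μ] (hf : Measurable f) :
    partitionEntropy μ f = ∫ x, -Real.log (μ.real (f ⁻¹' {f x})) ∂μ := by
  rw [integral_comp_label hf fun i => -Real.log (μ.real (f ⁻¹' {i}))]
  exact Finset.sum_congr rfl fun i _ => by simp [Real.negMulLog]

lemma partitionEntropy_comp_le [IsFiniteMeasure μ] (hg : Measurable g) (φ : κ → ι) :
    partitionEntropy μ (φ ∘ g) ≤ partitionEntropy μ g := by
  rw [partitionEntropy_eq_integral ((measurable_of_finite φ).comp hg)]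
  simp only [Function.comp_apply]
  rw [integral_comp_label hg fun k => -Real.log (μ.real ((φ ∘ g) ⁻¹' {φ k}))]
  refine Finset.sum_le_sum fun k _ => ?_
  rcases (measureReal_nonneg (μ := μ) (s := g ⁻¹' {k})).eq_or_lt with h0 | h0
  · simp [← h0]
  · have hsub : g ⁻¹' {k} ⊆ (φ ∘ g) ⁻¹' {φ k} := fun x hx => congrArg φ hx
    rw [Real.negMulLog, neg_mul, mul_neg, neg_le_neg_iff]
    gcongr
    exact measure_ne_top _ _

variable [IsProbabilityMeasure μ]

lemma partitionEntropy_nonneg {ι : Type*} [Fintype ι] (μ : Measure X) [IsProbabilityMeasure μ]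
    (f : X → ι) : 0 ≤ partitionEntropy μ f :=
  Finset.sum_nonneg fun _ _ => Real.negMulLog_nonneg measureReal_nonneg measureReal_le_one

lemma sum_measureReal_label (hf : Measurable f) : ∑ i, μ.real (f ⁻¹' {i}) = 1 := by
  simpa using (integral_comp_label (μ := μ) hf fun _ => 1).symm

lemma partitionEntropy_le_integral (hf : Measurable f) {Q : ι → ℝ} (hQ : ∀ i, 0 ≤ Q i)
    (hsum : ∑ i, Q i ≤ 1) (hpos : ∀ᵐ x ∂μ, 0 < Q (f x)) :
    partitionEntropy μ f ≤ ∫ x, -Real.log (Q (f x)) ∂μ := by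
  rw [integral_comp_label hf fun i => -Real.log (Q i)]
  refine sum_negMulLog_le (fun _ => measureReal_nonneg) hQ (fun i hi => ?_)
    (hsum.trans_eq (sum_measureReal_label hf).symm)
  refine (measureReal_eq_zero_iff).2 (measure_mono_null ?_ (ae_iff.1 hpos))
  rintro x rfl
  exact hi.not_gt

lemma measureReal_label_eq_of_integral_le (hf : Measurable f) {Q : ι → ℝ} (hQ : ∀ i, 0 < Q i)
    (hsum : ∑ i, Q i ≤ 1) (h : ∫ x, -Real.log (Q (f x)) ∂μ ≤ partitionEntropy μ f) (i : ι) :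
    μ.real (f ⁻¹' {i}) = Q i := by
  rw [integral_comp_label hf fun i => -Real.log (Q i)] at h
  exact congrFun (eq_of_le_sum_negMulLog (fun _ => measureReal_nonneg) hQ
    (hsum.trans_eq (sum_measureReal_label hf).symm) h) i

/-- Encoding `f` conditionally on `g`, with subprobability weights `c (g x)`, costs at least the
conditional entropy of `f` given `g`. -/
lemma partitionEntropy_prodMk_le_add_integral (hg : Measurable g) (hf : Measurable f)
    {c : κ → ι → ℝ} (hc : ∀ k i, 0 ≤ c k i) (hsum : ∀ k, ∑ i, c k i ≤ 1)
    (hpos : ∀ᵐ x ∂μ, 0 < c (g x) (f x)) :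
    partitionEntropy μ (fun x => (g x, f x)) ≤
      partitionEntropy μ g + ∫ x, -Real.log (c (g x) (f x)) ∂μ := by
  have hgf : Measurable fun x => (g x, f x) := hg.prodMk hf
  let Q : κ × ι → ℝ := fun z => μ.real (g ⁻¹' {z.1}) * c z.1 z.2
  have hQsum : ∑ z, Q z ≤ 1 := calc
    ∑ z, Q z = ∑ k, μ.real (g ⁻¹' {k}) * ∑ i, c k i := by
      simp only [Q, Fintype.sum_prod_type, Finset.mul_sum]
    _ ≤ ∑ k, μ.real (g ⁻¹' {k}) * 1 := by gcongr; exact hsum _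
    _ = 1 := by simpa using sum_measureReal_label hg
  have hgpos := ae_measureReal_label_pos μ g
  calc partitionEntropy μ (fun x => (g x, f x))
      ≤ ∫ x, -Real.log (Q (g x, f x)) ∂μ :=
        partitionEntropy_le_integral hgf (fun z => mul_nonneg measureReal_nonneg (hc _ _)) hQsum
          (by filter_upwards [hgpos, hpos] with x h1 h2 using mul_pos h1 h2)
    _ = ∫ x, (-Real.log (μ.real (g ⁻¹' {g x})) + -Real.log (c (g x) (f x))) ∂μ := by
        refine integral_congr_ae ?_
        filter_upwards [hgpos, hpos] with x h1 h2
        rw [Real.log_mul h1.ne' h2.ne', neg_add]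
    _ = _ := by
        rw [integral_add (integrable_comp_label hg fun k => -Real.log (μ.real (g ⁻¹' {k})))
          (integrable_comp_label hgf fun z => -Real.log (c z.1 z.2)),
          partitionEntropy_eq_integral hg]

lemma partitionEntropy_prodMk_le_add (hg : Measurable g) (hf : Measurable f) :
    partitionEntropy μ (fun x => (g x, f x)) ≤ partitionEntropy μ g + partitionEntropy μ f := by
  rw [partitionEntropy_eq_integral hf]
  exact partitionEntropy_prodMk_le_add_integral hg hf (c := fun _ i => μ.real (f ⁻¹' {i}))
    (fun _ _ => measureReal_nonneg) (fun _ => (sum_measureReal_label hf).le)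
    (ae_measureReal_label_pos μ f)

end PartitionEntropy

section NoisyCode

variable {X ι κ : Type*} [Fintype ι] [DecidableEq ι] {φ : κ → ι} {e : ℝ}

/-- Conditional weights that predict the label `φ k` and spread an error mass `e` uniformly over
all labels; they are the code by which a labelling close to `φ ∘ g` is read off from `g`. -/
def noisyCode (φ : κ → ι) (e : ℝ) (k : κ) (i : ι) : ℝ :=
  (if i = φ k then 1 - e else 0) + e / Fintype.card ι

lemma noisyCode_pos (he0 : 0 < e) (he1 : e ≤ 1) (k : κ) (i : ι) : 0 < noisyCode φ e k i := by
  have : Nonempty ι := ⟨i⟩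
  have : 0 < e / Fintype.card ι := by positivity
  rw [noisyCode]
  split_ifs <;> linarith

lemma sum_noisyCode (k : κ) : ∑ i, noisyCode φ e k i = 1 := by
  have : Nonempty ι := ⟨φ k⟩
  simp [noisyCode, Finset.sum_add_distrib, mul_div_cancel₀]

lemma neg_log_noisyCode_le (he0 : 0 < e) (he1 : e < 1) (k : κ) (i : ι) :
    -Real.log (noisyCode φ e k i) ≤
      -Real.log (1 - e) + if i = φ k then 0 else -Real.log (e / Fintype.card ι) := by
  have : Nonempty ι := ⟨i⟩
  have he : 0 < e / Fintype.card ι := by positivity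
  rw [noisyCode]
  split_ifs
  · rw [add_zero, neg_le_neg_iff]
    exact Real.log_le_log (by linarith) (by linarith)
  · rw [zero_add, le_add_iff_nonneg_left, neg_nonneg]
    exact Real.log_nonpos (by linarith) (by linarith)

variable [MeasurableSpace X] [MeasurableSpace ι] [MeasurableSingletonClass ι] [Finite κ]
  [MeasurableSpace κ] [MeasurableSingletonClass κ] {μ : Measure X} [IsProbabilityMeasure μ]

lemma integral_neg_log_noisyCode_le {f : X → ι} {g : X → κ} (hf : Measurable f)
    (hg : Measurable g) (he0 : 0 < e) (he1 : e < 1) :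
    ∫ x, -Real.log (noisyCode φ e (g x) (f x)) ∂μ ≤
      -Real.log (1 - e) + μ.real {x | f x ≠ φ (g x)} * -Real.log (e / Fintype.card ι) := by
  have hgf : Measurable fun x => (g x, f x) := hg.prodMk hf
  have hbad : MeasurableSet {x | f x ≠ φ (g x)} :=
    (measurableSet_eq_fun hf ((measurable_of_finite φ).comp hg)).compl
  set b := -Real.log (e / Fintype.card ι)
  have hind : Integrable ({x | f x ≠ φ (g x)}.indicator fun _ => b) μ :=
    (integrable_const b).indicator hbad
  calc ∫ x, -Real.log (noisyCode φ e (g x) (f x)) ∂μ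
      ≤ ∫ x, (-Real.log (1 - e) + {x | f x ≠ φ (g x)}.indicator (fun _ => b) x) ∂μ := by
        refine integral_mono (integrable_comp_label hgf fun z => -Real.log (noisyCode φ e z.1 z.2))
          ((integrable_const _).add hind) fun x => (neg_log_noisyCode_le he0 he1 _ _).trans_eq ?_
        by_cases hx : f x = φ (g x) <;> simp [hx, b]
    _ = _ := by
        rw [integral_add (integrable_const _) hind, integral_indicator_const b hbad]
        simp

lemma exists_noise_level {N ε : ℝ} (hN : 1 ≤ N) (hε : 0 < ε) :
    ∃ e ∈ Set.Ioo (0 : ℝ) 1, ∃ δ > 0, ∀ a < δ, -Real.log (1 - e) + a * -Real.log (e / N) ≤ ε := by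
  obtain ⟨e, he0, he1, hlog⟩ : ∃ e : ℝ, 0 < e ∧ e < 1 ∧ -Real.log (1 - e) = ε / 2 :=
    ⟨1 - Real.exp (-(ε / 2)), by simpa using hε, by simpa using Real.exp_pos _, by simp⟩
  have hcost : 0 < -Real.log (e / N) := neg_pos.2 <|
    Real.log_neg (by positivity) ((div_lt_one (by linarith)).2 (by linarith))
  refine ⟨e, ⟨he0, he1⟩, ε / 2 / -Real.log (e / N), by positivity, fun a ha => ?_⟩
  linarith [(lt_div_iff₀ hcost).1 ha]

end NoisyCode

/-! ### Kolmogorov–Sinai entropy and generating partitions -/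

section Itinerary

variable {X ι κ : Type*} {T : X → X} {g : X → κ}

lemma itinerary_add (a b : ℕ) (x : X) :
    itinerary T g (a + b) x = Fin.append (itinerary T g a x) (itinerary T g b (T^[a] x)) := by
  funext j
  refine Fin.addCases (fun i => ?_) (fun i => ?_) j
  · simp [itinerary]
  · rw [Fin.append_right, itinerary, itinerary, Fin.val_natAdd, add_comm,
      Function.iterate_add_apply]

/-- The block of length `m` that starts at position `j` of a word of length `n + m`. -/
def subword {n m : ℕ} (j : Fin n) (u : Fin (n + m) → κ) : Fin m → κ :=
  fun i => u ⟨i + j, by omega⟩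

lemma subword_itinerary {n m : ℕ} (j : Fin n) (x : X) :
    subword j (itinerary T g (n + m) x) = itinerary T g m (T^[j] x) := by
  funext i
  rw [subword, itinerary, itinerary, Function.iterate_add_apply]

variable [MeasurableSpace X] [MeasurableSpace κ]

lemma measurable_itinerary (hT : Measurable T) (hg : Measurable g) (n : ℕ) :
    Measurable (itinerary T g n) :=
  measurable_pi_lambda _ fun j => hg.comp (hT.iterate j)

end Itinerary

section KSEntropy

lemma sum_pi_prod_le_one {α β : Type*} [Fintype α] [DecidableEq α] [Fintype β] {c : α → β → ℝ}
    (hc : ∀ a b, 0 ≤ c a b) (hc1 : ∀ a, ∑ b, c a b ≤ 1) : ∑ w : α → β, ∏ a, c a (w a) ≤ 1 := by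
  rw [← Fintype.prod_sum]
  exact Finset.prod_le_one (fun a _ => Finset.sum_nonneg fun b _ => hc a b) fun a _ => hc1 a

lemma tendsto_div_shift {u : ℕ → ℝ} {l : ℝ} (hu : Tendsto (fun n : ℕ => u n / n) atTop (𝓝 l))
    (m : ℕ) : Tendsto (fun n : ℕ => u (n + m) / n) atTop (𝓝 l) := by
  have hratio : Tendsto (fun n : ℕ => (n + m : ℝ) / n) atTop (𝓝 1) := by
    simpa using (tendsto_natCast_div_add_atTop (m : ℝ)).inv₀ one_ne_zero
  rw [← mul_one l]
  refine ((hu.comp (tendsto_add_atTop_nat m)).mul hratio).congr' ?_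
  filter_upwards [eventually_ne_atTop 0] with n hn
  have : ((n : ℝ) + m) ≠ 0 := by positivity
  simp only [Function.comp, Nat.cast_add]
  field_simp

variable {X ι κ : Type*} [MeasurableSpace X]
  [Fintype ι] [MeasurableSpace ι] [MeasurableSingletonClass ι]
  [Fintype κ] [MeasurableSpace κ] [MeasurableSingletonClass κ]
  {μ : Measure X} {T : X → X} {f : X → ι} {g : X → κ}

lemma integral_comp_iterate (hT : MeasurePreserving T μ μ) (j : ℕ) {F : X → ℝ}
    (hF : Measurable F) : ∫ x, F (T^[j] x) ∂μ = ∫ x, F x ∂μ := by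
  conv_rhs => rw [← (hT.iterate j).map_eq]
  rw [integral_map (hT.iterate j).aemeasurable hF.aestronglyMeasurable]

lemma integral_neg_log_prod_iterate {ι : Type*} [Finite ι] [MeasurableSpace ι]
    [MeasurableSingletonClass ι] {f : X → ι} [IsFiniteMeasure μ] (hT : MeasurePreserving T μ μ)
    (hf : Measurable f) {c : ι → ℝ} (hc : ∀ i, 0 < c i) (n : ℕ) :
    ∫ x, -Real.log (∏ j : Fin n, c (f (T^[j] x))) ∂μ = n * ∫ x, -Real.log (c (f x)) ∂μ := by
  have hlog : ∀ x, -Real.log (∏ j : Fin n, c (f (T^[j] x))) =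
      ∑ j : Fin n, -Real.log (c (f (T^[j] x))) := fun x => by
    rw [Real.log_prod fun j _ => (hc _).ne', Finset.sum_neg_distrib]
  have hF : Measurable fun x => -Real.log (c (f x)) :=
    (measurable_of_finite fun i => -Real.log (c i)).comp hf
  simp_rw [hlog]
  rw [integral_finsetSum _ fun (j : Fin n) _ => integrable_comp_label
    (f := fun x => f (T^[j] x)) (hf.comp (hT.measurable.iterate j)) fun i => -Real.log (c i)]
  simp [integral_comp_iterate hT _ hF]

variable [IsProbabilityMeasure μ]

lemma subadditive_partitionEntropy_itinerary (hT : MeasurePreserving T μ μ) (hg : Measurable g) :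
    Subadditive fun n => partitionEntropy μ (itinerary T g n) := fun a b => by
  have ha := measurable_itinerary hT.measurable hg a
  have hb := measurable_itinerary hT.measurable hg b
  have hpair := ha.prodMk (hb.comp (hT.iterate a).measurable)
  calc partitionEntropy μ (itinerary T g (a + b))
      = partitionEntropy μ ((fun w => Fin.append w.1 w.2) ∘
          fun x => (itinerary T g a x, (itinerary T g b ∘ T^[a]) x)) :=
        congrArg _ (funext fun x => itinerary_add a b x)
    _ ≤ partitionEntropy μ fun x => (itinerary T g a x, (itinerary T g b ∘ T^[a]) x) :=
        partitionEntropy_comp_le hpair _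
    _ ≤ partitionEntropy μ (itinerary T g a) + partitionEntropy μ (itinerary T g b ∘ T^[a]) :=
        partitionEntropy_prodMk_le_add ha (hb.comp (hT.iterate a).measurable)
    _ = _ := by rw [partitionEntropy_comp_measurePreserving (hT.iterate a) hb]

lemma partitionEntropy_itinerary_le (hT : MeasurePreserving T μ μ) (hf : Measurable f)
    (hg : Measurable g) {m : ℕ} {c : (Fin m → κ) → ι → ℝ} (hc : ∀ u i, 0 < c u i)
    (hc1 : ∀ u, ∑ i, c u i ≤ 1) (n : ℕ) :
    partitionEntropy μ (itinerary T f n) ≤ partitionEntropy μ (itinerary T g (n + m)) +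
      n * ∫ x, -Real.log (c (itinerary T g m x) (f x)) ∂μ := by
  have hfn := measurable_itinerary hT.measurable hf n
  have hgn := fun k => measurable_itinerary hT.measurable hg k
  let C : (Fin (n + m) → κ) → (Fin n → ι) → ℝ := fun u w => ∏ j, c (subword j u) (w j)
  have hC : ∀ u w, 0 < C u w := fun u w => Finset.prod_pos fun j _ => hc _ _
  calc partitionEntropy μ (itinerary T f n)
      ≤ partitionEntropy μ fun x => (itinerary T g (n + m) x, itinerary T f n x) :=
        partitionEntropy_comp_le ((hgn _).prodMk hfn) Prod.snd
    _ ≤ partitionEntropy μ (itinerary T g (n + m)) +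
          ∫ x, -Real.log (C (itinerary T g (n + m) x) (itinerary T f n x)) ∂μ :=
        partitionEntropy_prodMk_le_add_integral (hgn _) hfn (fun u w => (hC u w).le)
          (fun u => sum_pi_prod_le_one (fun j i => (hc (subword j u) i).le) fun j => hc1 _)
          (ae_of_all _ fun x => hC _ _)
    _ = _ := by
        simp only [C, subword_itinerary]
        rw [← integral_neg_log_prod_iterate hT (f := fun x => (itinerary T g m x, f x))
          ((hgn m).prodMk hf) (c := fun z => c z.1 z.2) fun z => hc _ _]
        rfl

lemma entropyRate_le_of_code (hT : MeasurePreserving T μ μ) (hf : Measurable f)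
    (hg : Measurable g) {l : ℝ}
    (hl : Tendsto (fun n : ℕ => partitionEntropy μ (itinerary T g n) / n) atTop (𝓝 l))
    {m : ℕ} {c : (Fin m → κ) → ι → ℝ} (hc : ∀ u i, 0 < c u i) (hc1 : ∀ u, ∑ i, c u i ≤ 1) :
    entropyRate μ T f ≤
      ENNReal.ofReal (l + ∫ x, -Real.log (c (itinerary T g m x) (f x)) ∂μ) := by
  set I := ∫ x, -Real.log (c (itinerary T g m x) (f x)) ∂μ
  have hlim := (ENNReal.continuous_ofReal.tendsto (l + I)).comp
    ((tendsto_div_shift hl m).add_const I)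
  refine (limsup_le_limsup ?_).trans_eq hlim.limsup_eq
  filter_upwards [eventually_gt_atTop 0] with n hn
  have hn0 : (0 : ℝ) < n := by exact_mod_cast hn
  refine ENNReal.ofReal_le_ofReal ?_
  rw [div_le_iff₀ hn0, add_mul, div_mul_cancel₀ _ hn0.ne', mul_comm I]
  exact partitionEntropy_itinerary_le hT hf hg hc hc1 n

/-- The partition labelled by `g` generates: up to sets of small measure, every finite measurable
labelling is a function of a finite itinerary. -/
def IsGenerating (μ : Measure X) (T : X → X) (g : X → κ) : Prop :=
  ∀ ⦃M : ℕ⦄ ⦃f : X → Fin M⦄, Measurable f → ∀ δ > 0,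
    ∃ (m : ℕ) (φ : (Fin m → κ) → Fin M), μ.real {x | f x ≠ φ (itinerary T g m x)} < δ

/-- Half of the Kolmogorov–Sinai theorem. -/
lemma ksEntropy_le_of_isGenerating (hT : MeasurePreserving T μ μ) (hg : Measurable g)
    (hgen : IsGenerating μ T g) {N : ℕ} (hN : N ≠ 0) :
    ksEntropy μ T ≤ ENNReal.ofReal (partitionEntropy μ (itinerary T g N) / N) := by
  have hsub := subadditive_partitionEntropy_itinerary hT hg
  have hbdd : BddBelow (Set.range fun n : ℕ => partitionEntropy μ (itinerary T g n) / n) :=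
    ⟨0, by rintro _ ⟨n, rfl⟩; exact div_nonneg (partitionEntropy_nonneg μ _) n.cast_nonneg⟩
  refine iSup_le fun M => iSup_le fun f => iSup_le fun hf => ?_
  refine le_trans ?_ (ENNReal.ofReal_le_ofReal (hsub.lim_le_div hbdd hN))
  have hε : ∀ ε > 0, entropyRate μ T f ≤ ENNReal.ofReal (hsub.lim + ε) := fun ε hε => by
    obtain ⟨x₀⟩ := nonempty_of_isProbabilityMeasure μ
    have hM : (1 : ℝ) ≤ Fintype.card (Fin M) := by
      simpa [Nat.one_le_iff_ne_zero] using (f x₀).pos.ne'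
    obtain ⟨e, he, δ, hδ, hcost⟩ := exists_noise_level hM hε
    obtain ⟨m, φ, hφ⟩ := hgen hf δ hδ
    refine (entropyRate_le_of_code hT hf hg (hsub.tendsto_lim hbdd)
      (noisyCode_pos he.1 he.2.le) fun u => (sum_noisyCode (φ := φ) u).le).trans ?_
    gcongr
    exact (integral_neg_log_noisyCode_le hf (measurable_itinerary hT.measurable hg m)
      he.1 he.2).trans (hcost _ hφ)
  have hlim : Tendsto (fun ε => ENNReal.ofReal (hsub.lim + ε)) (𝓝[>] 0)
      (𝓝 (ENNReal.ofReal hsub.lim)) := by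
    have hcont : Continuous fun ε => ENNReal.ofReal (hsub.lim + ε) :=
      ENNReal.continuous_ofReal.comp (continuous_const.add continuous_id)
    simpa using (hcont.tendsto 0).mono_left nhdsWithin_le_nhds
  exact ge_of_tendsto hlim (eventually_nhdsWithin_of_forall hε)

end KSEntropy

/-! ### Words of the full shift -/

section Words

variable {q : ℕ}

/-- The word formed by the first `n` letters of a sequence. -/
def word (n : ℕ) (x : Shift q) : Fin n → Fin q := fun i => x i

lemma measurable_word (n : ℕ) : Measurable (word (q := q) n) :=
  measurable_pi_lambda _ fun _ => measurable_pi_apply _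

lemma measurable_shift : Measurable (shift (q := q)) :=
  measurable_pi_lambda _ fun _ => measurable_pi_apply _

lemma shift_iterate_apply (j i : ℕ) (x : Shift q) : shift^[j] x i = x (i + j) := by
  induction j generalizing x with
  | zero => rfl
  | succ j ih => rw [Function.iterate_succ_apply, ih, shift, add_assoc]

lemma itinerary_eval_zero (n : ℕ) : itinerary shift (fun x : Shift q => x 0) n = word n := by
  funext x j
  rw [itinerary, word, shift_iterate_apply, zero_add]

lemma mem_measurableCylinders_iff {s : Set (Shift q)} :
    s ∈ measurableCylinders (fun _ : ℕ => Fin q) ↔ ∃ m S, s = word m ⁻¹' S := by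
  rw [mem_measurableCylinders]
  constructor
  · rintro ⟨t, S, -, rfl⟩
    obtain ⟨m, hm⟩ : ∃ m, ∀ i ∈ t, i < m := ⟨t.sup id + 1, fun i hi =>
      Nat.lt_succ_of_le (Finset.le_sup (f := id) hi)⟩
    exact ⟨m, {u | (fun i : t => u ⟨i, hm i i.2⟩) ∈ S}, rfl⟩
  · rintro ⟨m, S, rfl⟩
    exact ⟨Finset.range m, {v | (fun i : Fin m => v ⟨i, by simp⟩) ∈ S},
      (Set.toFinite _).measurableSet, rfl⟩

lemma measure_preimage_word (μ : Measure (Shift q)) (m : ℕ) (S : Set (Fin m → Fin q)) :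
    μ (word m ⁻¹' S) = ∑ u ∈ S.toFinite.toFinset, μ (word m ⁻¹' {u}) := by
  rw [sum_measure_preimage_singleton _ fun u _ => measurable_word m (measurableSet_singleton u),
    S.toFinite.coe_toFinset]

lemma ext_of_word {μ ν : Measure (Shift q)} [IsFiniteMeasure μ]
    (h : ∀ m u, μ (word m ⁻¹' {u}) = ν (word m ⁻¹' {u})) : μ = ν := by
  have hword : ∀ m S, μ (word m ⁻¹' S) = ν (word m ⁻¹' S) := fun m S => by
    rw [measure_preimage_word, measure_preimage_word]
    exact Finset.sum_congr rfl fun u _ => h m u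
  refine ext_of_generate_finite _ (generateFrom_measurableCylinders (α := fun _ : ℕ => Fin q)).symm
    isPiSystem_measurableCylinders (fun s hs => ?_) (hword 0 Set.univ)
  obtain ⟨m, S, rfl⟩ := mem_measurableCylinders_iff.1 hs
  exact hword m S

lemma exists_word_symmDiff_lt (μ : Measure (Shift q)) [IsFiniteMeasure μ] {s : Set (Shift q)}
    (hs : MeasurableSet s) {ε : ℝ} (hε : 0 < ε) :
    ∃ (m : ℕ) (S : Set (Fin m → Fin q)), μ.real (symmDiff s (word m ⁻¹' S)) < ε := by
  have hdense := Measure.MeasureDense.of_generateFrom_isSetAlgebra_finite μ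
    isSetAlgebra_measurableCylinders
    (generateFrom_measurableCylinders (α := fun _ : ℕ => Fin q)).symm
  obtain ⟨t, ht, hlt⟩ := hdense.approx s hs (measure_ne_top _ _) ε hε
  obtain ⟨m, S, rfl⟩ := mem_measurableCylinders_iff.1 ht
  exact ⟨m, S, ENNReal.toReal_lt_of_lt_ofReal hlt⟩

/-- Sets that approximate the level sets of a labelling are decoded by choosing, at each point, a
label whose approximating set contains it. -/
lemma exists_decoder {X κ ι : Type*} [Nonempty ι] (f : X → ι) (g : X → κ) (S : ι → Set κ) :
    ∃ φ : κ → ι, {x | f x ≠ φ (g x)} ⊆ ⋃ i, symmDiff (f ⁻¹' {i}) (g ⁻¹' S i) := by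
  classical
  refine ⟨fun k => if h : ∃ i, k ∈ S i then h.choose else Classical.arbitrary ι, fun x hx => ?_⟩
  by_contra hcon
  have hiff : ∀ i, g x ∈ S i ↔ f x = i := fun i => by
    have := fun h => hcon (Set.mem_iUnion_of_mem i h)
    simp only [Set.mem_symmDiff, Set.mem_preimage, Set.mem_singleton_iff] at this
    tauto
  have hex : ∃ i, g x ∈ S i := ⟨f x, (hiff _).2 rfl⟩
  refine hx ?_
  simp only [dif_pos hex]
  exact (hiff _).1 hex.choose_spec

lemma isGenerating_eval_zero (μ : Measure (Shift q)) [IsProbabilityMeasure μ] :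
    IsGenerating μ shift fun x : Shift q => x 0 := fun M f hf δ hδ => by
  obtain ⟨x₀⟩ := nonempty_of_isProbabilityMeasure μ
  have : Nonempty (Fin M) := ⟨f x₀⟩
  have hM : (0 : ℝ) < M := by exact_mod_cast (f x₀).pos
  choose m S hS using fun i : Fin M =>
    exists_word_symmDiff_lt μ (hf (measurableSet_singleton i)) (div_pos hδ hM)
  have hle : ∀ i, m i ≤ Finset.univ.sup m := fun i => Finset.le_sup (Finset.mem_univ i)
  obtain ⟨φ, hφ⟩ := exists_decoder f (word (Finset.univ.sup m)) fun i =>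
    {u | (fun j : Fin (m i) => u (Fin.castLE (hle i) j)) ∈ S i}
  refine ⟨Finset.univ.sup m, φ, ?_⟩
  rw [itinerary_eval_zero]
  calc μ.real {x | f x ≠ φ (word _ x)}
      ≤ μ.real (⋃ i, symmDiff (f ⁻¹' {i}) (word (m i) ⁻¹' S i)) :=
        measureReal_mono hφ (measure_ne_top _ _)
    _ ≤ ∑ i, μ.real (symmDiff (f ⁻¹' {i}) (word (m i) ⁻¹' S i)) := measureReal_iUnion_fintype_le _
    _ < ∑ _i : Fin M, δ / M := Finset.sum_lt_sum_of_nonempty Finset.univ_nonempty fun i _ => hS i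
    _ = δ := by
      rw [Finset.sum_const, Finset.card_univ, Fintype.card_fin, nsmul_eq_mul,
        mul_div_cancel₀ _ hM.ne']

end Words

section Bernoulli

variable {q : ℕ} {p : Fin q → ℝ}

/-- The measure on letters with weights `p`. -/
def letterMeasure (p : Fin q → ℝ) : Measure (Fin q) :=
  ∑ i, ENNReal.ofReal (p i) • Measure.dirac i

lemma letterMeasure_singleton (p : Fin q → ℝ) (i : Fin q) :
    letterMeasure p {i} = ENNReal.ofReal (p i) := by
  rw [letterMeasure, Measure.finsetSum_apply, Finset.sum_eq_single i]
  · simp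
  · intro j _ hj
    simp [hj]
  · simp

lemma isProbabilityMeasure_letterMeasure (hp : p ∈ stdSimplex ℝ (Fin q)) :
    IsProbabilityMeasure (letterMeasure p) := by
  constructor
  rw [letterMeasure, Measure.finsetSum_apply]
  simp only [Measure.smul_apply, measure_univ, smul_eq_mul, mul_one]
  rw [← ENNReal.ofReal_sum_of_nonneg fun i _ => hp.1 i, hp.2, ENNReal.ofReal_one]

/-- The Bernoulli measure on the full shift with letter weights `p`. -/
def bernoulli (p : Fin q → ℝ) : Measure (Shift q) :=
  Measure.infinitePi fun _ : ℕ => letterMeasure p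

lemma bernoulli_word (hp : p ∈ stdSimplex ℝ (Fin q)) (m : ℕ) (u : Fin m → Fin q) :
    bernoulli p (word m ⁻¹' {u}) = ENNReal.ofReal (∏ i, p (u i)) := by
  have := isProbabilityMeasure_letterMeasure hp
  have hset : word m ⁻¹' {u} =
      Set.pi (Finset.range m : Set ℕ) fun j => if h : j < m then {u ⟨j, h⟩} else Set.univ := by
    ext x
    simp only [Set.mem_preimage, Set.mem_singleton_iff, Set.mem_pi, Finset.coe_range, Set.mem_Iio]
    refine ⟨fun h j hj => by simp [← h, hj, word], fun h => funext fun i => ?_⟩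
    simpa [word] using h i i.2
  rw [hset, bernoulli, Measure.infinitePi_pi _ fun j _ => (Set.toFinite _).measurableSet,
    ENNReal.ofReal_prod_of_nonneg fun i _ => hp.1 _, Finset.prod_range]
  exact Finset.prod_congr rfl fun i _ => by simp [letterMeasure_singleton]

lemma measurePreserving_shift_bernoulli (hp : p ∈ stdSimplex ℝ (Fin q)) :
    MeasurePreserving shift (bernoulli p) (bernoulli p) := by
  have := isProbabilityMeasure_letterMeasure hp
  refine ⟨measurable_shift, Measure.eq_infinitePi _ fun s t ht => ?_⟩
  have hset : shift ⁻¹' Set.pi (s : Set ℕ) t =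
      Set.pi (s.map ⟨Nat.succ, Nat.succ_injective⟩ : Finset ℕ) fun j => t (j - 1) := by
    ext x
    simp [shift]
  rw [Measure.map_apply measurable_shift (MeasurableSet.pi s.countable_toSet fun i _ => ht i),
    hset, bernoulli, Measure.infinitePi_pi _ fun j _ => ht _, Finset.prod_map]
  simp

lemma isInvariantProb_bernoulli (hp : p ∈ stdSimplex ℝ (Fin q)) :
    IsInvariantProb shift (bernoulli p) := by
  have := isProbabilityMeasure_letterMeasure hp
  exact ⟨by rw [bernoulli]; infer_instance, measurePreserving_shift_bernoulli hp⟩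

lemma uniformBernoulli_eq_bernoulli (q : ℕ) [NeZero q] :
    uniformBernoulli q = bernoulli fun _ : Fin q => 1 / (q : ℝ) := by
  have hq : (0 : ℝ) < q := by exact_mod_cast NeZero.pos q
  rw [uniformBernoulli, bernoulli]
  congr 1
  funext _
  refine Measure.ext_of_singleton fun i => ?_
  rw [letterMeasure_singleton, ProbabilityTheory.uniformOn_univ]
  simp [ENNReal.ofReal_inv_of_pos hq]

end Bernoulli

/-! ### Equilibrium states of one-letter potentials -/

section Softmax

variable {ι : Type*} [Fintype ι]

/-- The one-letter partition function `∑ᵢ exp cᵢ` of energies `c`. -/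
def expSum (c : ι → ℝ) : ℝ := ∑ i, Real.exp (c i)

/-- The one-letter Gibbs weights `exp cᵢ / ∑ⱼ exp cⱼ`. -/
def softmax (c : ι → ℝ) (i : ι) : ℝ := Real.exp (c i) / expSum c

variable [Nonempty ι]

lemma expSum_pos (c : ι → ℝ) : 0 < expSum c :=
  Finset.sum_pos (fun _ _ => Real.exp_pos _) Finset.univ_nonempty

lemma softmax_pos (c : ι → ℝ) (i : ι) : 0 < softmax c i := div_pos (Real.exp_pos _) (expSum_pos c)

lemma sum_softmax (c : ι → ℝ) : ∑ i, softmax c i = 1 := by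
  simp_rw [softmax]
  rw [← Finset.sum_div, ← expSum, div_self (expSum_pos c).ne']

lemma softmax_mem_stdSimplex (c : ι → ℝ) : softmax c ∈ stdSimplex ℝ ι :=
  ⟨fun i => (softmax_pos c i).le, sum_softmax c⟩

lemma neg_log_softmax (c : ι → ℝ) (i : ι) :
    -Real.log (softmax c i) = Real.log (expSum c) - c i := by
  rw [softmax, Real.log_div (Real.exp_pos _).ne' (expSum_pos c).ne', Real.log_exp, neg_sub]

end Softmax

section Equilibrium

variable {q : ℕ} {μ : Measure (Shift q)} {p c : Fin q → ℝ}

lemma sum_prod_letter (hp : ∑ i, p i = 1) (n : ℕ) : ∑ u : Fin n → Fin q, ∏ i, p (u i) = 1 := by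
  rw [← Fintype.prod_sum fun _ : Fin n => p, Finset.prod_const, hp, one_pow]

lemma integral_neg_log_prod_word [IsFiniteMeasure μ] (hμ : MeasurePreserving shift μ μ)
    (hp : ∀ i, 0 < p i) (n : ℕ) :
    ∫ x, -Real.log (∏ i, p (word n x i)) ∂μ = n * ∫ x, -Real.log (p (x 0)) ∂μ := by
  rw [← integral_neg_log_prod_iterate hμ (measurable_pi_apply 0) hp]
  simp only [shift_iterate_apply, zero_add, word]

lemma partitionEntropy_word_le [IsProbabilityMeasure μ] (hμ : MeasurePreserving shift μ μ)
    (hp : ∀ i, 0 < p i) (hp1 : ∑ i, p i = 1) (n : ℕ) :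
    partitionEntropy μ (word n) ≤ n * ∫ x, -Real.log (p (x 0)) ∂μ := by
  rw [← integral_neg_log_prod_word hμ hp]
  have hprod : ∀ u : Fin n → Fin q, 0 < ∏ i, p (u i) := fun u => Finset.prod_pos fun i _ => hp _
  exact partitionEntropy_le_integral (Q := fun u => ∏ i, p (u i)) (measurable_word n)
    (fun u => (hprod u).le) (sum_prod_letter hp1 n).le (ae_of_all _ fun x => hprod _)

lemma eq_bernoulli_of_le_partitionEntropy_word (hμ : IsInvariantProb shift μ)
    (hp : ∀ i, 0 < p i) (hp1 : ∑ i, p i = 1)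
    (h : ∀ n : ℕ, n * ∫ x, -Real.log (p (x 0)) ∂μ ≤ partitionEntropy μ (word n)) :
    μ = bernoulli p := by
  have := hμ.1
  refine ext_of_word fun n u => ?_
  have hu := measureReal_label_eq_of_integral_le (Q := fun u => ∏ i, p (u i)) (measurable_word n)
    (fun u => Finset.prod_pos fun i _ => hp _) (sum_prod_letter hp1 n).le
    ((integral_neg_log_prod_word hμ.2 hp n).trans_le (h n)) u
  rw [bernoulli_word ⟨fun i => (hp i).le, hp1⟩, ← hu, measureReal_def,
    ENNReal.ofReal_toReal (measure_ne_top _ _)]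

lemma ksEntropy_shift_le (hμ : IsInvariantProb shift μ) {n : ℕ} (hn : n ≠ 0) :
    ksEntropy μ shift ≤ ENNReal.ofReal (partitionEntropy μ (word n) / n) := by
  have := hμ.1
  rw [← itinerary_eval_zero]
  exact ksEntropy_le_of_isGenerating hμ.2 (measurable_pi_apply 0) (isGenerating_eval_zero μ) hn

lemma partitionEntropy_word_bernoulli (hp : ∀ i, 0 < p i) (hp1 : ∑ i, p i = 1) (n : ℕ) :
    partitionEntropy (bernoulli p) (word n) = n * ∫ x, -Real.log (p (x 0)) ∂(bernoulli p) := by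
  have hp' : p ∈ stdSimplex ℝ (Fin q) := ⟨fun i => (hp i).le, hp1⟩
  have hinv := isInvariantProb_bernoulli hp'
  have := hinv.1
  rw [← integral_neg_log_prod_word hinv.2 hp, partitionEntropy_eq_integral (measurable_word n)]
  simp_rw [measureReal_def, bernoulli_word hp',
    ENNReal.toReal_ofReal (Finset.prod_nonneg fun _ _ => hp'.1 _)]

lemma ksEntropy_bernoulli (hp : ∀ i, 0 < p i) (hp1 : ∑ i, p i = 1) :
    ksEntropy (bernoulli p) shift = ENNReal.ofReal (∫ x, -Real.log (p (x 0)) ∂(bernoulli p)) := by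
  have hp' : p ∈ stdSimplex ℝ (Fin q) := ⟨fun i => (hp i).le, hp1⟩
  apply le_antisymm
  · simpa [partitionEntropy_word_bernoulli hp hp1] using
      ksEntropy_shift_le (isInvariantProb_bernoulli hp') one_ne_zero
  · refine le_trans (ge_of_eq (Tendsto.limsup_eq (tendsto_const_nhds.congr' ?_)))
      (le_iSup_of_le q (le_iSup_of_le (fun x : Shift q => x 0)
        (le_iSup_of_le (measurable_pi_apply 0) le_rfl)))
    filter_upwards [eventually_ne_atTop 0] with n hn
    rw [itinerary_eval_zero, partitionEntropy_word_bernoulli hp hp1,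
      mul_div_cancel_left₀ _ (Nat.cast_ne_zero.2 hn)]

lemma integral_neg_log_softmax [NeZero q] (μ : Measure (Shift q)) [IsProbabilityMeasure μ]
    (c : Fin q → ℝ) :
    ∫ x, -Real.log (softmax c (x 0)) ∂μ = Real.log (expSum c) - ∫ x, c (x 0) ∂μ := by
  simp_rw [neg_log_softmax]
  rw [integral_sub (integrable_const _)
    (integrable_comp_label (f := fun x : Shift q => x 0) (measurable_pi_apply 0) c)]
  simp

lemma freeEnergy_le_of_ksEntropy_le {X : Type*} [MeasurableSpace X] {T : X → X} {ψ : X → ℝ}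
    {μ : Measure X} {h : ℝ} (h0 : 0 ≤ h) (hle : ksEntropy μ T ≤ ENNReal.ofReal h) :
    freeEnergy T ψ μ ≤ ((h + ∫ x, ψ x ∂μ : ℝ) : EReal) := by
  rw [freeEnergy, EReal.coe_add]
  have := EReal.coe_ennreal_le_coe_ennreal_iff.2 hle
  rw [EReal.coe_ennreal_ofReal, max_eq_left h0] at this
  exact add_le_add_left this _

lemma freeEnergy_le_partitionEntropy_word (hμ : IsInvariantProb shift μ) {n : ℕ} (hn : n ≠ 0)
    (ψ : Shift q → ℝ) :
    freeEnergy shift ψ μ ≤ ((partitionEntropy μ (word n) / n + ∫ x, ψ x ∂μ : ℝ) : EReal) := by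
  have := hμ.1
  exact freeEnergy_le_of_ksEntropy_le
    (div_nonneg (partitionEntropy_nonneg μ _) n.cast_nonneg) (ksEntropy_shift_le hμ hn)

variable [NeZero q]

lemma freeEnergy_le_log_expSum (hμ : IsInvariantProb shift μ) (c : Fin q → ℝ) :
    freeEnergy shift (fun x => c (x 0)) μ ≤ (Real.log (expSum c) : ℝ) := by
  have := hμ.1
  refine (freeEnergy_le_partitionEntropy_word hμ one_ne_zero _).trans (EReal.coe_le_coe_iff.2 ?_)
  have := partitionEntropy_word_le hμ.2 (softmax_pos c) (sum_softmax c) 1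
  rw [integral_neg_log_softmax] at this
  simp only [Nat.cast_one, div_one, one_mul] at this ⊢
  linarith

lemma freeEnergy_bernoulli_softmax (c : Fin q → ℝ) :
    freeEnergy shift (fun x => c (x 0)) (bernoulli (softmax c)) = (Real.log (expSum c) : ℝ) := by
  have := (isInvariantProb_bernoulli (softmax_mem_stdSimplex c)).1
  have hnonneg : 0 ≤ ∫ x, -Real.log (softmax c (x 0)) ∂(bernoulli (softmax c)) := by
    refine integral_nonneg fun x => neg_nonneg.2 (Real.log_nonpos (softmax_pos c _).le ?_)
    exact (mem_Icc_of_mem_stdSimplex (softmax_mem_stdSimplex c) _).2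
  rw [freeEnergy, ksEntropy_bernoulli (softmax_pos c) (sum_softmax c), EReal.coe_ennreal_ofReal,
    max_eq_left hnonneg, integral_neg_log_softmax, ← EReal.coe_add, sub_add_cancel]

lemma pressure_eq_log_expSum (c : Fin q → ℝ) :
    pressure shift (fun x : Shift q => c (x 0)) = (Real.log (expSum c) : ℝ) := by
  refine le_antisymm (iSup₂_le fun μ hμ => freeEnergy_le_log_expSum hμ c) ?_
  rw [← freeEnergy_bernoulli_softmax c]
  exact le_iSup₂_of_le _ (isInvariantProb_bernoulli (softmax_mem_stdSimplex c)) le_rfl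

theorem isDynamicalGibbs_bernoulli_softmax (c : Fin q → ℝ) :
    IsDynamicalGibbs shift (fun x => c (x 0)) (bernoulli (softmax c)) := by
  refine ⟨⟨isInvariantProb_bernoulli (softmax_mem_stdSimplex c), ?_⟩, ?_⟩
  · rw [freeEnergy_bernoulli_softmax, pressure_eq_log_expSum]
  rintro ν ⟨hν, hfree⟩
  have := hν.1
  refine eq_bernoulli_of_le_partitionEntropy_word hν (softmax_pos c) (sum_softmax c) fun n => ?_
  rcases eq_or_ne n 0 with rfl | hn
  · simpa using partitionEntropy_nonneg ν (word 0)
  have hle := freeEnergy_le_partitionEntropy_word hν hn fun x => c (x 0)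
  rw [hfree, pressure_eq_log_expSum, EReal.coe_le_coe_iff] at hle
  rw [integral_neg_log_softmax, mul_comm, ← le_div_iff₀ (Nat.cast_pos.2 hn.bot_lt)]
  linarith

lemma isDynamicalGibbs_potential (k : Fin q) (b : ℝ) :
    IsDynamicalGibbs shift (potential k b) (bernoulli (softmax (Pi.single k b))) := by
  have h : potential k b = fun x => (Pi.single k b : Fin q → ℝ) (x 0) := by
    funext x
    rw [potential, Pi.single_apply]
  rw [h]
  exact isDynamicalGibbs_bernoulli_softmax _

end Equilibrium

/-! ### Laplace's method -/

section Gaussian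

open Matrix

variable {ι : Type*} [Fintype ι]

lemma norm_sq_le_dotProduct_self (z : ι → ℝ) : ‖z‖ ^ 2 ≤ z ⬝ᵥ z := by
  have h : ‖z‖ ≤ √(z ⬝ᵥ z) := (pi_norm_le_iff_of_nonneg (Real.sqrt_nonneg _)).2 fun i => by
    refine Real.abs_le_sqrt ?_
    rw [sq]
    exact Finset.single_le_sum (f := fun j => z j * z j) (fun j _ => mul_self_nonneg _)
      (Finset.mem_univ i)
  exact (Real.le_sqrt (norm_nonneg z) (dotProduct_self_star_nonneg z)).1 h

lemma dotProduct_self_le_card_mul_norm_sq (z : ι → ℝ) : z ⬝ᵥ z ≤ Fintype.card ι * ‖z‖ ^ 2 := by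
  rw [← nsmul_eq_mul, ← Finset.card_univ]
  refine Finset.sum_le_card_nsmul _ _ _ fun i _ => ?_
  rw [← sq, ← sq_abs]
  exact pow_le_pow_left₀ (abs_nonneg _) (norm_le_pi_norm z i) 2

lemma integrable_exp_neg_mul_dotProduct_self {b : ℝ} (hb : 0 < b) :
    Integrable fun z : ι → ℝ => Real.exp (-(b * (z ⬝ᵥ z))) := by
  refine (Integrable.fintype_prod (f := fun _ : ι => fun x : ℝ => Real.exp (-b * x ^ 2))
    (μ := fun _ => volume) fun _ => integrable_exp_neg_mul_sq hb).congr (ae_of_all _ fun z => ?_)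
  simp only [← Real.exp_sum, dotProduct, ← sq, neg_mul, Finset.sum_neg_distrib, Finset.mul_sum]

/-- The integral of the unnormalized standard Gaussian density on `ι → ℝ`. -/
def gaussConst (ι : Type*) [Fintype ι] : ℝ := ∫ z : ι → ℝ, Real.exp (-((z ⬝ᵥ z) / 2))

lemma gaussConst_pos (ι : Type*) [Fintype ι] : 0 < gaussConst ι := by
  have hint := integrable_exp_neg_mul_dotProduct_self (ι := ι) one_half_pos
  simp only [one_div_mul_eq_div] at hint
  exact integral_exp_pos hint

variable {S : Matrix ι ι ℝ}

lemma exists_det_ne_zero_dotProduct_eq [DecidableEq ι] (hS : S.PosDef) :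
    ∃ B : Matrix ι ι ℝ, B.det ≠ 0 ∧ |B.det| = √S.det ∧
      ∀ z, z ⬝ᵥ (S *ᵥ z) = (B *ᵥ z) ⬝ᵥ (B *ᵥ z) := by
  open scoped MatrixOrder in
  obtain ⟨B, hB⟩ := CStarAlgebra.nonneg_iff_eq_star_mul_self.mp hS.posSemidef.nonneg
  have hBt : S = Bᵀ * B := by
    rw [hB, star_eq_conjTranspose, conjTranspose_eq_transpose_of_trivial]
  have hdet : S.det = B.det ^ 2 := by rw [hBt, det_mul, det_transpose, sq]
  refine ⟨B, fun h0 => hS.det_pos.ne' ?_, ?_, fun z => ?_⟩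
  · rw [hdet, h0, zero_pow two_ne_zero]
  · rw [hdet, Real.sqrt_sq_eq_abs]
  · rw [hBt, ← mulVec_mulVec, dotProduct_mulVec, vecMul_transpose]

lemma integral_exp_neg_posDef [DecidableEq ι] (hS : S.PosDef) :
    ∫ z : ι → ℝ, Real.exp (-((z ⬝ᵥ (S *ᵥ z)) / 2)) = gaussConst ι / √S.det := by
  obtain ⟨B, hB0, hBdet, hB⟩ := exists_det_ne_zero_dotProduct_eq hS
  have hmeas : Measurable (toLin' B) := (LinearMap.continuous_on_pi _).measurable
  have hcont : Continuous fun z : ι → ℝ => Real.exp (-((z ⬝ᵥ z) / 2)) := by fun_prop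
  have h := integral_map (μ := volume) hmeas.aemeasurable hcont.aestronglyMeasurable
  rw [Real.map_matrix_volume_pi_eq_smul_volume_pi hB0, integral_smul_measure,
    ENNReal.toReal_ofReal (abs_nonneg _), abs_inv, hBdet, smul_eq_mul, ← gaussConst] at h
  simp_rw [hB, ← toLin'_apply]
  rw [← h, div_eq_inv_mul]

lemma exists_mul_dotProduct_self_le (hS : S.PosDef) :
    ∃ κ > 0, ∀ z, κ * (z ⬝ᵥ z) ≤ z ⬝ᵥ (S *ᵥ z) := by
  classical
  obtain ⟨B, hB0, -, hB⟩ := exists_det_ne_zero_dotProduct_eq hS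
  let T : (ι → ℝ) →L[ℝ] (ι → ℝ) := (toLin' B⁻¹).toContinuousLinearMap
  have hT : ∀ z, T (B *ᵥ z) = z := fun z => by
    change toLin' B⁻¹ (B *ᵥ z) = z
    rw [toLin'_apply, mulVec_mulVec, nonsing_inv_mul _ (isUnit_iff_ne_zero.2 hB0), one_mulVec]
  refine ⟨(Fintype.card ι * ‖T‖ ^ 2 + 1)⁻¹, by positivity, fun z => ?_⟩
  have hnonneg := (sq_nonneg _).trans (norm_sq_le_dotProduct_self (B *ᵥ z))
  rw [hB, inv_mul_le_iff₀ (by positivity)]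
  calc z ⬝ᵥ z ≤ Fintype.card ι * ‖T (B *ᵥ z)‖ ^ 2 := by
        rw [hT]
        exact dotProduct_self_le_card_mul_norm_sq z
    _ ≤ Fintype.card ι * (‖T‖ * ‖B *ᵥ z‖) ^ 2 := by
        gcongr
        exact T.le_opNorm _
    _ = Fintype.card ι * ‖T‖ ^ 2 * ‖B *ᵥ z‖ ^ 2 := by ring
    _ ≤ Fintype.card ι * ‖T‖ ^ 2 * ((B *ᵥ z) ⬝ᵥ (B *ᵥ z)) := by
        gcongr
        exact norm_sq_le_dotProduct_self _
    _ ≤ _ := by linarith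

end Gaussian

section Laplace

open Matrix

variable {ι : Type*} [Fintype ι] {F h : (ι → ℝ) → ℝ} {y z : ι → ℝ} {S : Matrix ι ι ℝ} {K : ℝ}

/-- `F` has the critical point `y` with second-order Taylor expansion given by the Hessian `S`. -/
def HasCriticalHessian (F : (ι → ℝ) → ℝ) (y : ι → ℝ) (S : Matrix ι ι ℝ) : Prop :=
  (fun z => F (y + z) - F y - (z ⬝ᵥ (S *ᵥ z)) / 2) =o[𝓝 0] fun z => ‖z‖ ^ 2

lemma tendsto_inv_sqrt_smul {ι : Type*} (z : ι → ℝ) :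
    Tendsto (fun t : ℝ => (√t)⁻¹ • z) atTop (𝓝 0) := by
  simpa using (tendsto_inv_atTop_zero.comp Real.tendsto_sqrt_atTop).smul_const z

lemma inv_sqrt_smul_dotProduct_mulVec {t : ℝ} (ht : 0 < t) (S : Matrix ι ι ℝ) (z : ι → ℝ) :
    ((√t)⁻¹ • z) ⬝ᵥ (S *ᵥ ((√t)⁻¹ • z)) = t⁻¹ * (z ⬝ᵥ (S *ᵥ z)) := by
  rw [mulVec_smul, smul_dotProduct, dotProduct_smul, smul_eq_mul, smul_eq_mul, ← mul_assoc,
    ← mul_inv, Real.mul_self_sqrt ht.le]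

lemma HasCriticalHessian.tendsto_rescaled (hF : HasCriticalHessian F y S) (z : ι → ℝ) :
    Tendsto (fun t : ℝ => t * (F (y + (√t)⁻¹ • z) - F y)) atTop (𝓝 ((z ⬝ᵥ (S *ᵥ z)) / 2)) := by
  have hbig : ((fun w : ι → ℝ => ‖w‖ ^ 2) ∘ fun t : ℝ => (√t)⁻¹ • z) =O[atTop]
      fun t : ℝ => t⁻¹ := by
    refine Asymptotics.IsBigO.of_bound (‖z‖ ^ 2) ?_
    filter_upwards [eventually_ge_atTop 0] with t ht
    rw [Function.comp, norm_smul, norm_inv, Real.norm_of_nonneg (Real.sqrt_nonneg t), mul_pow,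
      inv_pow, Real.sq_sqrt ht, Real.norm_of_nonneg (by positivity),
      Real.norm_of_nonneg (by positivity), mul_comm]
  have hlim := ((hF.comp_tendsto (tendsto_inv_sqrt_smul z)).trans_isBigO
    hbig).tendsto_div_nhds_zero.add_const ((z ⬝ᵥ (S *ᵥ z)) / 2)
  rw [zero_add] at hlim
  refine hlim.congr' ?_
  filter_upwards [eventually_gt_atTop 0] with t ht
  rw [Function.comp, inv_sqrt_smul_dotProduct_mulVec ht]
  field_simp
  ring

lemma HasCriticalHessian.dotProduct_mulVec_nonneg (hF : HasCriticalHessian F y S)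
    (hmin : ∀ z, F y ≤ F z) (z : ι → ℝ) : 0 ≤ z ⬝ᵥ (S *ᵥ z) := by
  have h : 0 ≤ (z ⬝ᵥ (S *ᵥ z)) / 2 := ge_of_tendsto (hF.tendsto_rescaled z) <| by
    filter_upwards [eventually_ge_atTop 0] with t ht
    exact mul_nonneg ht (sub_nonneg.2 (hmin _))
  linarith

lemma HasCriticalHessian.eventually_le (hF : HasCriticalHessian F y S) (hS : S.PosDef) :
    ∃ κ > 0, ∀ᶠ z in 𝓝 0, κ * (z ⬝ᵥ z) ≤ F (y + z) - F y := by
  obtain ⟨κ, hκ, hlow⟩ := exists_mul_dotProduct_self_le hS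
  refine ⟨κ / 4, by positivity, ?_⟩
  filter_upwards [hF.bound (c := κ / 4) (by positivity)] with z hz
  rw [Real.norm_eq_abs, Real.norm_of_nonneg (by positivity)] at hz
  have hnorm := mul_le_mul_of_nonneg_left (norm_sq_le_dotProduct_self z) hκ.le
  linarith [(abs_le.1 hz).1, hlow z]

lemma pow_card_mul_setIntegral_ball {r : ℝ} (hr : 0 ≤ r) (φ : (ι → ℝ) → ℝ) (y : ι → ℝ) (δ : ℝ) :
    r ^ Fintype.card ι * ∫ z in Metric.ball y δ, φ z =
      ∫ z, (Metric.ball 0 δ).indicator (fun w => φ (y + w)) (r⁻¹ • z) := by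
  rw [Measure.integral_comp_inv_smul_of_nonneg _ _ hr, Module.finrank_fintype_fun_eq_card,
    smul_eq_mul, ← integral_indicator measurableSet_ball, ← integral_add_left_eq_self _ y]
  congr 2
  funext w
  simp [Set.indicator]

lemma norm_indicator_ball_inv_sqrt_smul_le {κ δ t : ℝ} (ht : 0 < t)
    (hlow : ∀ z ∈ Metric.ball 0 δ, κ * (z ⬝ᵥ z) ≤ F (y + z) - F y) (hK : ∀ z, |h z| ≤ K)
    (z : ι → ℝ) :
    ‖(Metric.ball 0 δ).indicator (fun w => h (y + w) * Real.exp (-(t * (F (y + w) - F y))))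
      ((√t)⁻¹ • z)‖ ≤ K * Real.exp (-(κ * (z ⬝ᵥ z))) := by
  have hK0 : 0 ≤ K := (abs_nonneg _).trans (hK y)
  by_cases hz : (√t)⁻¹ • z ∈ Metric.ball (0 : ι → ℝ) δ
  · rw [Set.indicator_of_mem hz, norm_mul, Real.norm_eq_abs,
      Real.norm_of_nonneg (Real.exp_nonneg _)]
    refine mul_le_mul (hK _) (Real.exp_le_exp.2 (neg_le_neg ?_)) (Real.exp_nonneg _) hK0
    classical
    have hscale := inv_sqrt_smul_dotProduct_mulVec ht 1 z
    rw [one_mulVec, one_mulVec] at hscale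
    calc κ * (z ⬝ᵥ z) = t * (κ * (((√t)⁻¹ • z) ⬝ᵥ ((√t)⁻¹ • z))) := by
          rw [hscale]
          field_simp
      _ ≤ _ := mul_le_mul_of_nonneg_left (hlow _ hz) ht.le
  · rw [Set.indicator_of_notMem hz, norm_zero]
    positivity

lemma HasCriticalHessian.eventually_tendsto_laplace_ball [DecidableEq ι]
    (hF : HasCriticalHessian F y S) (hS : S.PosDef) (hFc : Continuous F) (hc : Continuous h)
    (hK : ∀ z, |h z| ≤ K) :
    ∀ᶠ δ in 𝓝[>] (0 : ℝ), Tendsto (fun t : ℝ => √t ^ Fintype.card ι *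
      ∫ z in Metric.ball y δ, h z * Real.exp (-(t * (F z - F y)))) atTop
      (𝓝 (h y * (gaussConst ι / √S.det))) := by
  obtain ⟨κ, hκ, hlow⟩ := hF.eventually_le hS
  obtain ⟨δ₀, hδ₀, hball⟩ := Metric.eventually_nhds_iff_ball.1 hlow
  filter_upwards [Ioc_mem_nhdsGT hδ₀] with δ hδ
  simp_rw [pow_card_mul_setIntegral_ball (Real.sqrt_nonneg _), ← integral_exp_neg_posDef hS,
    ← integral_const_mul]
  refine tendsto_integral_filter_of_dominated_convergence
    (fun z => K * Real.exp (-(κ * (z ⬝ᵥ z)))) (Eventually.of_forall fun t => ?_) ?_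
    ((integrable_exp_neg_mul_dotProduct_self hκ).const_mul K) (ae_of_all _ fun z => ?_)
  · have hcont : Continuous fun w => h (y + w) * Real.exp (-(t * (F (y + w) - F y))) := by fun_prop
    exact ((hcont.measurable.indicator measurableSet_ball).comp
      (measurable_const_smul _)).aestronglyMeasurable
  · filter_upwards [eventually_gt_atTop 0] with t ht
    exact ae_of_all _ (norm_indicator_ball_inv_sqrt_smul_le ht
      (fun z hz => hball z (Metric.ball_subset_ball hδ.2 hz)) hK)
  · have hcont : Continuous fun w => h (y + w) := by fun_prop
    have hh := (hcont.tendsto 0).comp (tendsto_inv_sqrt_smul z)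
    rw [add_zero] at hh
    refine (hh.mul ((Real.continuous_exp.tendsto _).comp (hF.tendsto_rescaled z).neg)).congr' ?_
    filter_upwards [tendsto_inv_sqrt_smul z (Metric.ball_mem_nhds 0 hδ.1)] with t ht
    rw [Set.indicator_of_mem (Set.mem_preimage.1 ht)]
    rfl

variable {c : ℝ} {s : Set (ι → ℝ)}

lemma exists_pos_forall_add_le {E : Type*} [TopologicalSpace E] {F : E → ℝ} {s : Set E}
    (hFc : Continuous F) (hcoe : Tendsto F (cocompact E) atTop) (hs : IsClosed s)
    (hc : ∀ z ∈ s, c < F z) : ∃ η > 0, ∀ z ∈ s, c + η ≤ F z := by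
  rcases s.eq_empty_or_nonempty with rfl | ⟨x₀, hx₀⟩
  · exact ⟨1, one_pos, by simp⟩
  obtain ⟨x, hx, hmin⟩ := hFc.continuousOn.exists_isMinOn' hs hx₀
    ((hcoe.eventually_ge_atTop _).filter_mono inf_le_left)
  exact ⟨F x - c, sub_pos.2 (hc x hx), fun z hz => by linarith [isMinOn_iff.1 hmin z hz]⟩

lemma norm_setIntegral_laplace_le (hint : Integrable fun z => Real.exp (-F z))
    (hs : MeasurableSet s) {η : ℝ} (hη : ∀ z ∈ s, c + η ≤ F z) (hK : ∀ z, |h z| ≤ K) {t : ℝ}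
    (ht : 1 ≤ t) :
    ‖∫ z in s, h z * Real.exp (-(t * (F z - c)))‖ ≤
      K * Real.exp (c + η) * (∫ z in s, Real.exp (-F z)) / Real.exp (η * t) := by
  have hpt : ∀ z ∈ s, ‖h z * Real.exp (-(t * (F z - c)))‖ ≤
      K * (Real.exp (c + η) / Real.exp (η * t) * Real.exp (-F z)) := fun z hz => by
    rw [norm_mul, Real.norm_eq_abs, Real.norm_of_nonneg (Real.exp_nonneg _), ← Real.exp_sub,
      ← Real.exp_add]
    refine mul_le_mul (hK z) (Real.exp_le_exp.2 ?_) (Real.exp_nonneg _)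
      ((abs_nonneg _).trans (hK z))
    nlinarith [hη z hz]
  refine (norm_integral_le_of_norm_le ((hint.integrableOn.const_mul _).const_mul _)
    ((ae_restrict_iff' hs).2 (ae_of_all _ hpt))).trans_eq ?_
  rw [integral_const_mul, integral_const_mul]
  ring

lemma tendsto_laplace_of_lt (hFc : Continuous F) (hcoe : Tendsto F (cocompact _) atTop)
    (hint : Integrable fun z => Real.exp (-F z)) (hs : IsClosed s) (hc : ∀ z ∈ s, c < F z)
    (hK : ∀ z, |h z| ≤ K) (d : ℕ) :
    Tendsto (fun t : ℝ => √t ^ d * ∫ z in s, h z * Real.exp (-(t * (F z - c)))) atTop (𝓝 0) := by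
  obtain ⟨η, hη, hgap⟩ := exists_pos_forall_add_le hFc hcoe hs hc
  set I := K * Real.exp (c + η) * ∫ z in s, Real.exp (-F z)
  have hdecay := ((isLittleO_pow_exp_pos_mul_atTop (k := d) hη).tendsto_div_nhds_zero).const_mul I
  rw [mul_zero] at hdecay
  refine squeeze_zero_norm' ?_ hdecay
  filter_upwards [eventually_ge_atTop 1] with t ht
  have hsqrt : √t ≤ t := (Real.sqrt_le_left (by linarith)).2 (by nlinarith)
  rw [norm_mul, norm_pow, Real.norm_of_nonneg (Real.sqrt_nonneg _)]
  calc √t ^ d * ‖∫ z in s, h z * Real.exp (-(t * (F z - c)))‖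
      ≤ t ^ d * (I / Real.exp (η * t)) := by
        gcongr
        exact norm_setIntegral_laplace_le hint hs.measurableSet hgap hK ht
    _ = _ := by ring

lemma eventually_pairwise_disjoint_ball {κ X : Type*} [Finite κ] [MetricSpace X] {m : κ → X}
    (hm : Function.Injective m) :
    ∀ᶠ ε in 𝓝[>] (0 : ℝ), Pairwise (Function.onFun Disjoint fun i => Metric.ball (m i) ε) := by
  refine eventually_all.2 fun i => eventually_all.2 fun j => ?_
  rcases eq_or_ne i j with hij | hij
  · exact Eventually.of_forall fun ε hne => absurd hij hne
  have hd : 0 < dist (m i) (m j) / 2 := half_pos (dist_pos.2 (hm.ne hij))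
  filter_upwards [Ioc_mem_nhdsGT hd] with ε hε _
  exact Metric.ball_disjoint_ball (by linarith [hε.2])

theorem tendsto_laplace [DecidableEq ι] {κ : Type*} [Fintype κ] {m : κ → ι → ℝ}
    {S : κ → Matrix ι ι ℝ} (hFc : Continuous F) (hcoe : Tendsto F (cocompact _) atTop)
    (hint : Integrable fun z => Real.exp (-F z)) (hle : ∀ z, c ≤ F z)
    (hmin : ∀ z, F z = c ↔ ∃ i, m i = z) (hinj : Function.Injective m)
    (hF : ∀ i, HasCriticalHessian F (m i) (S i)) (hS : ∀ i, (S i).PosDef)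
    (hc : Continuous h) (hK : ∀ z, |h z| ≤ K) :
    Tendsto (fun t : ℝ => √t ^ Fintype.card ι * ∫ z, h z * Real.exp (-(t * (F z - c)))) atTop
      (𝓝 (∑ i, h (m i) * (gaussConst ι / √(S i).det))) := by
  have hlocal := eventually_all.2 fun i =>
    (hF i).eventually_tendsto_laplace_ball (hS i) hFc hc hK
  obtain ⟨δ, ⟨hlocal, hdisj⟩, hδ⟩ :=
    ((hlocal.and (eventually_pairwise_disjoint_ball hinj)).and self_mem_nhdsWithin).exists
  simp only [fun i => (hmin (m i)).2 ⟨i, rfl⟩] at hlocal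
  have hopen : IsOpen (⋃ i, Metric.ball (m i) δ) := isOpen_iUnion fun i => Metric.isOpen_ball
  have htail := tendsto_laplace_of_lt hFc hcoe hint (c := c) hopen.isClosed_compl (fun z hz => by
    refine (hle z).lt_of_ne' fun heq => hz ?_
    obtain ⟨i, rfl⟩ := (hmin z).1 heq
    exact Set.mem_iUnion_of_mem i (Metric.mem_ball_self hδ)) hK (Fintype.card ι)
  have hsum := (tendsto_finsetSum Finset.univ fun i _ => hlocal i).add htail
  rw [add_zero] at hsum
  refine hsum.congr' ?_
  filter_upwards [eventually_ge_atTop 1] with t ht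
  have hintt : Integrable fun z => h z * Real.exp (-(t * (F z - c))) := by
    refine Integrable.bdd_mul ?_ hc.aestronglyMeasurable (ae_of_all _ hK)
    refine (hint.const_mul (Real.exp c)).mono'
      (by fun_prop : Continuous fun z => Real.exp (-(t * (F z - c)))).aestronglyMeasurable
      (ae_of_all _ fun z => ?_)
    rw [Real.norm_of_nonneg (Real.exp_nonneg _), ← Real.exp_add, Real.exp_le_exp]
    nlinarith [hle z]
  rw [← Finset.mul_sum, ← mul_add, ← integral_iUnion_fintype (fun i => measurableSet_ball) hdisj
    fun i => hintt.integrableOn, integral_add_compl hopen.measurableSet hintt]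

end Laplace

/-! ### The mean-field energy -/

section LogSumExp

open Asymptotics Matrix

lemma exp_sub_quadratic_isLittleO :
    (fun x : ℝ => Real.exp x - 1 - x - x ^ 2 / 2) =o[𝓝 0] fun x => x ^ 2 := by
  refine (Real.exp_sub_sum_range_succ_isLittleO_pow 2).congr_left fun x => ?_
  simp only [Finset.sum_range_succ, Finset.sum_range_zero, Nat.factorial]
  norm_num
  ring

lemma log_one_add_sub_quadratic_isLittleO :
    (fun x : ℝ => Real.log (1 + x) - x + x ^ 2 / 2) =o[𝓝 0] fun x => x ^ 2 := by
  have hO : (fun x : ℝ => Real.log (1 + x) - x + x ^ 2 / 2) =O[𝓝 0] fun x => x ^ 3 := by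
    refine IsBigO.of_bound 2 ?_
    filter_upwards [Metric.ball_mem_nhds (0 : ℝ) one_half_pos] with x hx
    rw [mem_ball_zero_iff, Real.norm_eq_abs] at hx
    have h := Real.abs_log_sub_add_sum_range_le (x := -x) (by rw [abs_neg]; linarith) 2
    simp only [Finset.sum_range_succ, Finset.sum_range_zero, abs_neg, sub_neg_eq_add] at h
    rw [Real.norm_eq_abs, norm_pow, Real.norm_eq_abs]
    calc |Real.log (1 + x) - x + x ^ 2 / 2| ≤ |x| ^ 3 / (1 - |x|) := by
          convert h using 2
          norm_num
          ring
      _ ≤ 2 * |x| ^ 3 := by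
          rw [div_le_iff₀ (by linarith)]
          nlinarith [pow_nonneg (abs_nonneg x) 3]
  exact hO.trans_isLittleO (isLittleO_pow_pow (by norm_num))

variable {ι : Type*} [Fintype ι] {p : ι → ℝ}

lemma sum_mul_isBigO_norm_pow (p : ι → ℝ) (n : ℕ) :
    (fun x : ι → ℝ => ∑ i, p i * x i ^ n) =O[𝓝 0] fun x => ‖x‖ ^ n :=
  IsBigO.fun_sum fun i _ => .const_mul_left (.pow (.of_bound 1 (.of_forall fun x => by
    rw [norm_norm, one_mul]
    exact norm_le_pi_norm x i)) n) _

lemma sum_mul_exp_sub_quadratic_isLittleO (hp : ∑ i, p i = 1) :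
    (fun x : ι → ℝ => ∑ i, p i * Real.exp (x i) - 1 - p ⬝ᵥ x - (∑ i, p i * x i ^ 2) / 2)
      =o[𝓝 0] fun x => ‖x‖ ^ 2 := by
  have h : (fun x : ι → ℝ => ∑ i, p i * (Real.exp (x i) - 1 - x i - x i ^ 2 / 2)) =o[𝓝 0]
      fun x => ‖x‖ ^ 2 := IsLittleO.fun_sum fun i _ => .const_mul_left
    ((exp_sub_quadratic_isLittleO.comp_tendsto ((continuous_apply i).tendsto' 0 0 rfl)).trans_isBigO
      (.of_bound 1 (.of_forall fun x => by
        rw [Function.comp, norm_pow, norm_pow, norm_norm, one_mul]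
        gcongr
        exact norm_le_pi_norm x i))) _
  refine h.congr_left fun x => ?_
  rw [dotProduct, Finset.sum_div]
  nth_rw 2 [← hp]
  simp only [← Finset.sum_sub_distrib]
  exact Finset.sum_congr rfl fun i _ => by ring

/-- The second-order expansion of the cumulant generating function of the weights `p`. -/
lemma log_sum_mul_exp_isLittleO (hp : ∑ i, p i = 1) :
    (fun x : ι → ℝ => Real.log (∑ i, p i * Real.exp (x i)) - p ⬝ᵥ x -
      (∑ i, p i * x i ^ 2 - (p ⬝ᵥ x) ^ 2) / 2) =o[𝓝 0] fun x => ‖x‖ ^ 2 := by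
  set u : (ι → ℝ) → ℝ := fun x => ∑ i, p i * Real.exp (x i) - 1 with hu
  have hexp := sum_mul_exp_sub_quadratic_isLittleO hp
  have hlin : (fun x => p ⬝ᵥ x) =O[𝓝 0] fun x => ‖x‖ := by
    simpa only [pow_one] using! sum_mul_isBigO_norm_pow p 1
  have hsq : (fun x : ι → ℝ => ‖x‖ ^ 2) =o[𝓝 0] fun x => ‖x‖ :=
    (isLittleO_pow_id one_lt_two).comp_tendsto tendsto_norm_zero
  have hsub : (fun x => u x - p ⬝ᵥ x) =O[𝓝 0] fun x => ‖x‖ ^ 2 := by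
    refine (hexp.isBigO.add ((sum_mul_isBigO_norm_pow p 2).const_mul_left (1 / 2))).congr_left
      fun x => ?_
    ring
  have hu1 : u =O[𝓝 0] fun x => ‖x‖ :=
    ((hsub.trans hsq.isBigO).add hlin).congr_left fun x => by ring
  have hu2 : (fun x => u x ^ 2 - (p ⬝ᵥ x) ^ 2) =o[𝓝 0] fun x => ‖x‖ ^ 2 :=
    ((hsub.trans_isLittleO hsq).mul_isBigO (hu1.add hlin)).congr (fun x => by ring) fun x => by ring
  have hu0 : Tendsto u (𝓝 0) (𝓝 0) :=
    (by fun_prop : Continuous u).tendsto' 0 0 (by simp [hu, hp])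
  have hlog := (log_one_add_sub_quadratic_isLittleO.comp_tendsto hu0).trans_isBigO (hu1.pow 2)
  refine ((hlog.add hexp).sub (hu2.const_mul_left (1 / 2))).congr_left fun x => ?_
  simp only [Function.comp, hu, add_sub_cancel]
  ring

lemma dotProduct_le_log_sum_mul_exp (hp : p ∈ stdSimplex ℝ ι) (x : ι → ℝ) :
    p ⬝ᵥ x ≤ Real.log (∑ i, p i * Real.exp (x i)) := by
  have hjensen : Real.exp (p ⬝ᵥ x) ≤ ∑ i, p i * Real.exp (x i) :=
    convexOn_exp.map_sum_le (fun i _ => hp.1 i) hp.2 fun i _ => Set.mem_univ _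
  exact (Real.le_log_iff_exp_le ((Real.exp_pos _).trans_le hjensen)).2 hjensen

end LogSumExp

section MeanField

open Matrix

variable {ι : Type*} [Fintype ι] {β : ℝ} {y : ι → ℝ}

/-- The mean-field energy `β|y|²/2 - log ∑ᵢ exp (β yᵢ)`, the rate function of the
Hubbard–Stratonovich field. -/
def mfEnergy (β : ℝ) (y : ι → ℝ) : ℝ := β / 2 * (y ⬝ᵥ y) - Real.log (expSum (β • y))

/-- The global minimizers of the mean-field energy. -/
def minimizers (ι : Type*) [Fintype ι] (β : ℝ) : Set (ι → ℝ) :=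
  {y | ∀ z : ι → ℝ, mfEnergy β y ≤ mfEnergy β z}

/-- The Hessian `β I - β² (diag p - p pᵀ)` of the mean-field energy at a point whose softmax weights
are `p`. -/
def hessian [DecidableEq ι] (β : ℝ) (p : ι → ℝ) : Matrix ι ι ℝ :=
  β • 1 - β ^ 2 • (diagonal p - vecMulVec p p)

variable [Nonempty ι]

lemma continuous_mfEnergy (β : ℝ) : Continuous (mfEnergy (ι := ι) β) := by
  have hexp : Continuous fun y : ι → ℝ => expSum (β • y) := by
    unfold expSum
    fun_prop
  have hlog := hexp.log fun y => (expSum_pos _).ne'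
  unfold mfEnergy
  fun_prop

lemma log_expSum_le (x : ι → ℝ) : Real.log (expSum x) ≤ Real.log (Fintype.card ι) + ‖x‖ := by
  have hle : expSum x ≤ Fintype.card ι * Real.exp ‖x‖ := by
    rw [← nsmul_eq_mul, ← Finset.card_univ]
    exact Finset.sum_le_card_nsmul _ _ _ fun i _ =>
      Real.exp_le_exp.2 ((le_abs_self _).trans (norm_le_pi_norm x i))
  have hlog := Real.log_le_log (expSum_pos x) hle
  rwa [Real.log_mul (by positivity) (Real.exp_pos _).ne', Real.log_exp] at hlog

lemma le_mfEnergy (hβ : 0 ≤ β) (y : ι → ℝ) :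
    β / 4 * (y ⬝ᵥ y) - (β + Real.log (Fintype.card ι)) ≤ mfEnergy β y := by
  have hlog := log_expSum_le (β • y)
  rw [norm_smul, Real.norm_of_nonneg hβ] at hlog
  have hnorm := mul_le_mul_of_nonneg_left (norm_sq_le_dotProduct_self y) hβ
  rw [mfEnergy]
  nlinarith [mul_nonneg hβ (sq_nonneg (‖y‖ - 2))]

lemma tendsto_mfEnergy_cocompact (hβ : 0 < β) :
    Tendsto (mfEnergy (ι := ι) β) (cocompact _) atTop := by
  have hnorm : Tendsto (fun y : ι → ℝ => β / 4 * ‖y‖ ^ 2 - (β + Real.log (Fintype.card ι)))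
      (cocompact _) atTop :=
    tendsto_atTop_add_const_right _ _ (((tendsto_pow_atTop two_ne_zero).comp
      tendsto_norm_cocompact_atTop).const_mul_atTop (by positivity))
  refine tendsto_atTop_mono (fun y => le_trans ?_ (le_mfEnergy hβ.le y)) hnorm
  gcongr
  exact norm_sq_le_dotProduct_self y

lemma integrable_exp_neg_mfEnergy (hβ : 0 < β) :
    Integrable fun y : ι → ℝ => Real.exp (-mfEnergy β y) := by
  refine ((integrable_exp_neg_mul_dotProduct_self (b := β / 4) (by positivity)).const_mul
    (Real.exp (β + Real.log (Fintype.card ι)))).mono'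
    (continuous_mfEnergy β).neg.rexp.aestronglyMeasurable (ae_of_all _ fun y => ?_)
  rw [Real.norm_of_nonneg (Real.exp_nonneg _), ← Real.exp_add, Real.exp_le_exp]
  linarith [le_mfEnergy hβ.le y]

lemma minimizers_nonempty (hβ : 0 < β) : (minimizers ι β).Nonempty :=
  (continuous_mfEnergy β).exists_forall_le (tendsto_mfEnergy_cocompact hβ)

lemma mfEnergy_add_sub (β : ℝ) (y z : ι → ℝ) :
    mfEnergy β (y + z) - mfEnergy β y = β * (y ⬝ᵥ z) + β / 2 * (z ⬝ᵥ z) -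
      Real.log (∑ i, softmax (β • y) i * Real.exp ((β • z) i)) := by
  have hsum : ∑ i, softmax (β • y) i * Real.exp ((β • z) i) =
      expSum (β • (y + z)) / expSum (β • y) := by
    rw [expSum, Finset.sum_div]
    refine Finset.sum_congr rfl fun i _ => ?_
    rw [softmax, smul_add, Pi.add_apply, Real.exp_add]
    ring
  rw [hsum, Real.log_div (expSum_pos _).ne' (expSum_pos _).ne', mfEnergy, mfEnergy,
    add_dotProduct, dotProduct_add, dotProduct_add, dotProduct_comm z y]
  ring

lemma mfEnergy_softmax_le (β : ℝ) (y : ι → ℝ) :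
    mfEnergy β (softmax (β • y)) ≤
      mfEnergy β y - β / 2 * ((softmax (β • y) - y) ⬝ᵥ (softmax (β • y) - y)) := by
  set z := softmax (β • y) - y
  have hsub := mfEnergy_add_sub β y z
  have hle := dotProduct_le_log_sum_mul_exp (softmax_mem_stdSimplex (β • y)) (β • z)
  have hy : softmax (β • y) = y + z := (add_sub_cancel _ _).symm
  nth_rw 1 [hy, dotProduct_smul, add_dotProduct, smul_eq_mul] at hle
  rw [hy]
  linarith

lemma softmax_eq_of_mem_minimizers (hβ : 0 < β) (hy : y ∈ minimizers ι β) :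
    softmax (β • y) = y := by
  have hle := (hy _).trans (mfEnergy_softmax_le β y)
  have hsq := norm_sq_le_dotProduct_self (softmax (β • y) - y)
  have hzero : ‖softmax (β • y) - y‖ ^ 2 ≤ 0 := by
    by_contra! hpos
    nlinarith
  exact sub_eq_zero.1 (norm_eq_zero.1 (pow_eq_zero_iff two_ne_zero |>.1
    (hzero.antisymm (sq_nonneg _))))

variable [DecidableEq ι]

omit [Nonempty ι] in
lemma dotProduct_hessian_mulVec (β : ℝ) (p z : ι → ℝ) :
    z ⬝ᵥ (hessian β p *ᵥ z) =
      β * (z ⬝ᵥ z) - β ^ 2 * (∑ i, p i * z i ^ 2 - (p ⬝ᵥ z) ^ 2) := by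
  have hdiag : z ⬝ᵥ (diagonal p *ᵥ z) = ∑ i, p i * z i ^ 2 :=
    Finset.sum_congr rfl fun i _ => by rw [mulVec_diagonal]; ring
  have hrank : z ⬝ᵥ (vecMulVec p p *ᵥ z) = (p ⬝ᵥ z) ^ 2 := by
    rw [vecMulVec_mulVec, dotProduct_smul, dotProduct_comm z p, sq]
    rfl
  rw [hessian, sub_mulVec, smul_mulVec, smul_mulVec, sub_mulVec, one_mulVec, dotProduct_sub,
    dotProduct_smul, dotProduct_smul, dotProduct_sub, hdiag, hrank, smul_eq_mul, smul_eq_mul]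

lemma hasCriticalHessian_mfEnergy (hy : softmax (β • y) = y) :
    HasCriticalHessian (mfEnergy β) y (hessian β y) := by
  have hsum : ∑ i, y i = 1 := hy ▸ sum_softmax (β • y)
  have hscale : Tendsto (fun z : ι → ℝ => β • z) (𝓝 0) (𝓝 0) :=
    (continuous_const_smul β).tendsto' 0 0 (smul_zero β)
  have hO : ((fun x : ι → ℝ => ‖x‖ ^ 2) ∘ fun z => β • z) =O[𝓝 0] fun z => ‖z‖ ^ 2 :=
    .of_bound (|β| ^ 2) (.of_forall fun z => by
      rw [Function.comp, norm_smul, mul_pow, norm_mul, norm_pow, norm_norm, Real.norm_eq_abs])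
  refine (((log_sum_mul_exp_isLittleO hsum).comp_tendsto hscale).trans_isBigO
    hO).neg_left.congr_left fun z => ?_
  have hsq : ∑ i, y i * (β • z) i ^ 2 = β ^ 2 * ∑ i, y i * z i ^ 2 := by
    rw [Finset.mul_sum]
    exact Finset.sum_congr rfl fun i _ => by rw [Pi.smul_apply, smul_eq_mul]; ring
  rw [mfEnergy_add_sub, dotProduct_hessian_mulVec, hy, Function.comp, hsq, dotProduct_smul,
    smul_eq_mul]
  ring

omit [Fintype ι] [Nonempty ι] in
lemma isHermitian_hessian (β : ℝ) (p : ι → ℝ) : (hessian β p).IsHermitian := by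
  have hrank : (vecMulVec p p).IsHermitian := by
    rw [IsHermitian, conjTranspose_eq_transpose_of_trivial, transpose_vecMulVec]
  exact (isHermitian_one.smul (.all β)).sub
    (((isHermitian_diagonal p).sub hrank).smul (.all _))

lemma posSemidef_hessian (hβ : 0 < β) (hy : y ∈ minimizers ι β) : (hessian β y).PosSemidef :=
  .of_dotProduct_mulVec_nonneg (isHermitian_hessian β y) fun z =>
    (hasCriticalHessian_mfEnergy (softmax_eq_of_mem_minimizers hβ hy)).dotProduct_mulVec_nonneg hy z

end MeanField

/-! ### The magnetization and the Kearns–Saul inequality -/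

section Magnetization

variable {r x y c : ℝ}

/-- The magnetization `(eˣ - 1) / (eˣ + r - 1)` of a letter in an external field `x`, for `r`
letters: the difference of the softmax weights of the favoured letter and of any other one. -/
def magnetization (r x : ℝ) : ℝ := (Real.exp x - 1) / (Real.exp x + r - 1)

/-- The value `(r - 2) / (2 (r - 1))` of the magnetization at its inflection point
`log (r - 1)`. -/
def inflection (r : ℝ) : ℝ := (r - 2) / (2 * (r - 1))

/-- The primitive of the magnetization that vanishes at `0`; up to a factor it is the cumulant
generating function of a centred Bernoulli variable of parameter `1 / r`. -/
def cumulant (r x : ℝ) : ℝ := (r * Real.log ((Real.exp x + r - 1) / r) - x) / (r - 1)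

lemma exp_add_sub_one_pos (hr : 1 ≤ r) (x : ℝ) : 0 < Real.exp x + r - 1 := by
  linarith [Real.exp_pos x]

lemma magnetization_zero (r : ℝ) : magnetization r 0 = 0 := by
  rw [magnetization, Real.exp_zero, sub_self, zero_div]

lemma magnetization_lt_one (hr : 1 ≤ r) (x : ℝ) : magnetization r x < 1 :=
  (div_lt_one (exp_add_sub_one_pos hr x)).2 (by linarith)

lemma hasDerivAt_magnetization (hr : 1 ≤ r) (x : ℝ) : HasDerivAt (magnetization r)
    ((1 + (r - 1) * magnetization r x) * (1 - magnetization r x) / r) x := by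
  have hpos := exp_add_sub_one_pos hr x
  have h := ((Real.hasDerivAt_exp x).sub_const 1).div
    (((Real.hasDerivAt_exp x).add_const r).sub_const 1) hpos.ne'
  refine h.congr_deriv ?_
  rw [magnetization]
  field_simp
  ring

lemma continuous_magnetization (hr : 1 ≤ r) : Continuous (magnetization r) :=
  continuous_iff_continuousAt.2 fun x => (hasDerivAt_magnetization hr x).continuousAt

lemma strictMono_magnetization (hr : 1 ≤ r) : StrictMono (magnetization r) := by
  intro x y hxy
  rw [magnetization, magnetization, div_lt_div_iff₀ (exp_add_sub_one_pos hr x)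
    (exp_add_sub_one_pos hr y)]
  nlinarith [Real.exp_lt_exp.2 hxy]

lemma magnetization_log (hr : 1 < r) : magnetization r (Real.log (r - 1)) = inflection r := by
  rw [magnetization, inflection, Real.exp_log (sub_pos.2 hr)]
  congr 1 <;> ring

lemma magnetization_reflect (hr : 1 < r) (x : ℝ) :
    magnetization r (2 * Real.log (r - 1) - x) = 2 * inflection r - magnetization r x := by
  have hr0 := sub_pos.2 hr
  have hpos := exp_add_sub_one_pos hr.le x
  have hexp : Real.exp (2 * Real.log (r - 1) - x) = (r - 1) ^ 2 / Real.exp x := by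
    rw [Real.exp_sub, two_mul, Real.exp_add, Real.exp_log hr0, sq]
  have hden : (r - 1) ^ 2 / Real.exp x + r - 1 = (r - 1) * (Real.exp x + r - 1) / Real.exp x := by
    field_simp
    ring
  rw [magnetization, magnetization, inflection, hexp, hden]
  field_simp
  ring

lemma magnetization_two_mul_log (hr : 1 < r) :
    magnetization r (2 * Real.log (r - 1)) = 2 * inflection r := by
  simpa only [sub_zero, magnetization_zero] using magnetization_reflect hr 0

lemma deriv_magnetization_lt_iff (hr : 1 < r) :
    deriv (magnetization r) x < deriv (magnetization r) y ↔
      0 < (magnetization r y - magnetization r x) *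
        (2 * inflection r - magnetization r x - magnetization r y) := by
  have hr0 := sub_pos.2 hr
  have hsub : deriv (magnetization r) y - deriv (magnetization r) x = (r - 1) / r *
      ((magnetization r y - magnetization r x) *
        (2 * inflection r - magnetization r x - magnetization r y)) := by
    rw [(hasDerivAt_magnetization hr.le x).deriv, (hasDerivAt_magnetization hr.le y).deriv,
      inflection]
    field_simp
    ring
  rw [← sub_pos, hsub]
  exact mul_pos_iff_of_pos_left (by positivity)

lemma strictConvexOn_magnetization (hr : 1 < r) :
    StrictConvexOn ℝ (Set.Iic (Real.log (r - 1))) (magnetization r) := by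
  refine StrictMonoOn.strictConvexOn_of_deriv (convex_Iic _)
    (continuous_magnetization hr.le).continuousOn fun x hx y hy hxy => ?_
  rw [interior_Iic, Set.mem_Iio] at hx hy
  have hmono := strictMono_magnetization hr.le
  refine (deriv_magnetization_lt_iff hr).2 (mul_pos (sub_pos.2 (hmono hxy)) ?_)
  linarith [hmono hx, hmono hy, magnetization_log hr]

lemma strictConcaveOn_magnetization (hr : 1 < r) :
    StrictConcaveOn ℝ (Set.Ici (Real.log (r - 1))) (magnetization r) := by
  refine StrictAntiOn.strictConcaveOn_of_deriv (convex_Ici _)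
    (continuous_magnetization hr.le).continuousOn fun x hx y hy hxy => ?_
  rw [interior_Ici, Set.mem_Ioi] at hx hy
  have hmono := strictMono_magnetization hr.le
  refine (deriv_magnetization_lt_iff hr).2 (mul_pos_of_neg_of_neg (sub_neg.2 (hmono hxy)) ?_)
  linarith [hmono hx, hmono hy, magnetization_log hr]

lemma hasDerivAt_cumulant (hr : 1 < r) (x : ℝ) :
    HasDerivAt (cumulant r) (magnetization r x) x := by
  have hr0 := sub_pos.2 hr
  have hpos := exp_add_sub_one_pos hr.le x
  have hlog := ((((Real.hasDerivAt_exp x).add_const r).sub_const 1).div_const r).log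
    (div_pos hpos (by linarith)).ne'
  refine (((hlog.const_mul r).sub (hasDerivAt_id x)).div_const (r - 1)).congr_deriv ?_
  rw [magnetization]
  field_simp
  ring

lemma cumulant_zero (hr : r ≠ 0) : cumulant r 0 = 0 := by
  rw [cumulant, Real.exp_zero, add_sub_cancel_left, div_self hr, Real.log_one, mul_zero, sub_zero,
    zero_div]

lemma cumulant_reflect (hr : 1 < r) (x : ℝ) : cumulant r (2 * Real.log (r - 1) - x) =
    cumulant r x + 2 * inflection r * (Real.log (r - 1) - x) := by
  have hr0 := sub_pos.2 hr
  have hpos := exp_add_sub_one_pos hr.le x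
  have hlog : Real.log ((Real.exp (2 * Real.log (r - 1) - x) + r - 1) / r) =
      Real.log (r - 1) - x + Real.log ((Real.exp x + r - 1) / r) := by
    have hexp : (Real.exp (2 * Real.log (r - 1) - x) + r - 1) / r =
        Real.exp (Real.log (r - 1) - x) * ((Real.exp x + r - 1) / r) := by
      rw [Real.exp_sub, Real.exp_sub, two_mul, Real.exp_add, Real.exp_log hr0]
      field_simp
      ring
    rw [hexp, Real.log_mul (Real.exp_pos _).ne' (by positivity), Real.log_exp]
  rw [cumulant, cumulant, hlog, inflection]
  field_simp
  ring

/-- On the convex branch the magnetization crosses a line through the origin only once more, from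
below, so `c y² / 2 - cumulant r y` is smallest at the origin. -/
lemma cumulant_lt_of_magnetization_le (hr : 1 < r) (hx0 : 0 < x) (hx : x ≤ Real.log (r - 1))
    (hc : magnetization r x ≤ c * x) (hyx : y ≤ x) (hy : y ≠ 0) :
    cumulant r y < c / 2 * y ^ 2 := by
  set D : ℝ → ℝ := fun z => c / 2 * z ^ 2 - cumulant r z with hD
  have hderiv (z : ℝ) : HasDerivAt D (c * z - magnetization r z) z :=
    (((hasDerivAt_pow 2 z).const_mul _).sub (hasDerivAt_cumulant hr z)).congr_deriv (by ring)
  have hcont : Continuous D := continuous_iff_continuousAt.2 fun z => (hderiv z).continuousAt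
  have hchord (z : ℝ) (hzx : z < x) (hz : z ≠ 0) : magnetization r z / z < c := by
    have h := (strictConvexOn_magnetization hr).secant_strict_mono (a := 0) (hx0.le.trans hx)
      (hzx.le.trans hx) hx hz hx0.ne' hzx
    rw [magnetization_zero, sub_zero, sub_zero, sub_zero, sub_zero] at h
    exact h.trans_le ((div_le_iff₀ hx0).2 hc)
  have hD0 : D 0 = 0 := by
    rw [hD]
    norm_num [cumulant_zero (by linarith : r ≠ 0)]
  suffices D 0 < D y from sub_pos.1 (hD0 ▸ this)
  rcases hy.lt_or_gt with hy | hy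
  · refine strictAntiOn_of_deriv_neg (convex_Iic 0) hcont.continuousOn (fun z hz => ?_)
      hy.le Set.self_mem_Iic hy
    rw [interior_Iic, Set.mem_Iio] at hz
    rw [(hderiv z).deriv]
    linarith [(div_lt_iff_of_neg hz).1 (hchord z (hz.trans hx0) hz.ne)]
  · refine strictMonoOn_of_deriv_pos (convex_Icc 0 x) hcont.continuousOn (fun z hz => ?_)
      (Set.left_mem_Icc.2 hx0.le) ⟨hy.le, hyx⟩ hy
    rw [interior_Icc] at hz
    rw [(hderiv z).deriv]
    linarith [(div_lt_iff₀ hz.1).1 (hchord z hz.2 hz.1.ne')]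

end Magnetization

section CriticalTemperature

variable {q : ℕ} {β s x : ℝ}

lemma log_sub_one_pos (hq : 2 < q) : 0 < Real.log ((q : ℝ) - 1) :=
  Real.log_pos (lt_sub_iff_add_lt.2 (by exact_mod_cast hq))

lemma betaC_mul_inflection (hq : 2 < q) : betaC q * inflection q = Real.log ((q : ℝ) - 1) := by
  have hr : (2 : ℝ) < q := by exact_mod_cast hq
  have h1 : (q : ℝ) - 1 ≠ 0 := by linarith
  have h2 : (q : ℝ) - 2 ≠ 0 := by linarith
  rw [betaC, inflection]
  field_simp

lemma inflection_pos (hq : 2 < q) : 0 < inflection q := by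
  have hr : (2 : ℝ) < q := by exact_mod_cast hq
  exact div_pos (by linarith) (by linarith)

lemma betaC_pos (hq : 2 < q) : 0 < betaC q :=
  pos_of_mul_pos_left (betaC_mul_inflection hq ▸ log_sub_one_pos hq) (inflection_pos hq).le

lemma inflection_eq (hq : 2 < q) : inflection q = (betaC q)⁻¹ * Real.log ((q : ℝ) - 1) := by
  rw [← betaC_mul_inflection hq, inv_mul_cancel_left₀ (betaC_pos hq).ne']

lemma cumulant_lt_of_ne (hq : 2 < q) (hx0 : x ≠ 0) (hx : x ≠ 2 * Real.log ((q : ℝ) - 1)) :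
    cumulant q x < (betaC q)⁻¹ / 2 * x ^ 2 := by
  have hr : (1 : ℝ) < q := by exact_mod_cast one_lt_two.trans hq
  have hbelow (y : ℝ) (hy : y ≤ Real.log ((q : ℝ) - 1)) (hy0 : y ≠ 0) :
      cumulant q y < (betaC q)⁻¹ / 2 * y ^ 2 :=
    cumulant_lt_of_magnetization_le hr (log_sub_one_pos hq) le_rfl
      (by rw [magnetization_log hr, inflection_eq hq]) hy hy0
  rcases le_total x (Real.log ((q : ℝ) - 1)) with hle | hle
  · exact hbelow x hle hx0
  · have h := hbelow (2 * Real.log ((q : ℝ) - 1) - x) (by linarith) (sub_ne_zero.2 hx.symm)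
    rw [cumulant_reflect hr, inflection_eq hq] at h
    linarith

lemma cumulant_two_mul_log (hq : 2 < q) : cumulant q (2 * Real.log ((q : ℝ) - 1)) =
    (betaC q)⁻¹ / 2 * (2 * Real.log ((q : ℝ) - 1)) ^ 2 := by
  have hr : (1 : ℝ) < q := by exact_mod_cast one_lt_two.trans hq
  have h := cumulant_reflect hr 0
  rw [sub_zero, sub_zero, cumulant_zero (by linarith), inflection_eq hq] at h
  rw [h]
  ring

/-- The Kearns–Saul inequality. -/
lemma cumulant_le (hq : 2 < q) (x : ℝ) : cumulant q x ≤ (betaC q)⁻¹ / 2 * x ^ 2 := by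
  by_cases hx0 : x = 0
  · rw [hx0, cumulant_zero (by positivity)]
    norm_num
  by_cases hx : x = 2 * Real.log ((q : ℝ) - 1)
  · rw [hx, cumulant_two_mul_log hq]
  · exact (cumulant_lt_of_ne hq hx0 hx).le

lemma mem_meanFieldRoots : s ∈ meanFieldRoots q β ↔ s = magnetization q (β * s) := Iff.rfl

lemma zero_mem_meanFieldRoots (q : ℕ) (β : ℝ) : 0 ∈ meanFieldRoots q β := by
  rw [mem_meanFieldRoots, mul_zero, magnetization_zero]

lemma two_mul_inflection_mem_meanFieldRoots (hq : 2 < q) :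
    2 * inflection q ∈ meanFieldRoots q (betaC q) := by
  rw [mem_meanFieldRoots, mul_left_comm, betaC_mul_inflection hq,
    magnetization_two_mul_log (by exact_mod_cast one_lt_two.trans hq)]

lemma isGreatest_sSup_meanFieldRoots (hq : 1 ≤ q) (β : ℝ) :
    IsGreatest (meanFieldRoots q β) (sSup (meanFieldRoots q β)) := by
  have hr : (1 : ℝ) ≤ q := by exact_mod_cast hq
  have hclosed : IsClosed (meanFieldRoots q β) :=
    isClosed_eq continuous_id ((continuous_magnetization hr).comp (continuous_const_mul β))
  have hbdd : BddAbove (meanFieldRoots q β) :=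
    ⟨1, fun s hs => (mem_meanFieldRoots.1 hs).trans_le (magnetization_lt_one hr _).le⟩
  exact ⟨hclosed.csSup_mem ⟨0, zero_mem_meanFieldRoots q β⟩ hbdd, fun s hs => le_csSup hbdd hs⟩

lemma isGreatest_sBeta (hq : 1 ≤ q) (hβ : betaC q ≤ β) :
    IsGreatest (meanFieldRoots q β) (sBeta q β) := by
  rw [sBeta, if_neg hβ.not_gt]
  exact isGreatest_sSup_meanFieldRoots hq β

lemma slope_magnetization_le (hq : 2 < q) (hβ : betaC q ≤ β) (hs : s ∈ meanFieldRoots q β)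
    (hlog : Real.log ((q : ℝ) - 1) < β * s) :
    slope (magnetization q) (Real.log ((q : ℝ) - 1)) (β * s) ≤ β⁻¹ := by
  have hr : (1 : ℝ) < q := by exact_mod_cast one_lt_two.trans hq
  have hβ0 := (betaC_pos hq).trans_le hβ
  have hle : β⁻¹ * Real.log ((q : ℝ) - 1) ≤ inflection q := by
    rw [inflection_eq hq]
    exact mul_le_mul_of_nonneg_right (inv_anti₀ (betaC_pos hq) hβ) (log_sub_one_pos hq).le
  rw [slope_def_field, div_le_iff₀ (sub_pos.2 hlog), ← mem_meanFieldRoots.1 hs,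
    magnetization_log hr, mul_sub, inv_mul_cancel_left₀ hβ0.ne']
  linarith

/-- The magnetization is concave beyond its inflection point, so it meets there the line of slope
`β⁻¹` at most once, and transversally. -/
lemma deriv_magnetization_lt (hq : 2 < q) (hβ : betaC q ≤ β) (hs : s ∈ meanFieldRoots q β)
    (hlog : Real.log ((q : ℝ) - 1) < β * s) : deriv (magnetization q) (β * s) < β⁻¹ := by
  have hr : (1 : ℝ) < q := by exact_mod_cast one_lt_two.trans hq
  exact ((strictConcaveOn_magnetization hr).deriv_lt_slope Set.self_mem_Ici hlog.le hlog
    (hasDerivAt_magnetization hr.le _).differentiableAt).trans_le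
      (slope_magnetization_le hq hβ hs hlog)

lemma meanFieldRoots_le_of_log_lt (hq : 2 < q) (hβ : betaC q ≤ β) {t : ℝ}
    (hs : s ∈ meanFieldRoots q β) (hlog : Real.log ((q : ℝ) - 1) < β * s)
    (ht : t ∈ meanFieldRoots q β) : t ≤ s := by
  have hr : (1 : ℝ) < q := by exact_mod_cast one_lt_two.trans hq
  have hβ0 := (betaC_pos hq).trans_le hβ
  by_contra! hlt
  have hmul : β * s < β * t := mul_lt_mul_of_pos_left hlt hβ0
  have hslope := (strictConcaveOn_magnetization hr).slope_anti_adjacent Set.self_mem_Ici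
    (hlog.le.trans hmul.le) hlog hmul
  rw [← mem_meanFieldRoots.1 hs, ← mem_meanFieldRoots.1 ht, ← mul_sub,
    div_mul_cancel_right₀ (sub_pos.2 hlt).ne'] at hslope
  have hle := slope_magnetization_le hq hβ hs hlog
  rw [slope_def_field, ← mem_meanFieldRoots.1 hs] at hle
  exact hslope.not_ge hle

lemma eq_sBeta_of_log_lt (hq : 2 < q) (hβ : betaC q ≤ β) (hs : s ∈ meanFieldRoots q β)
    (hlog : Real.log ((q : ℝ) - 1) < β * s) : s = sBeta q β :=
  have hmax := isGreatest_sBeta (one_le_two.trans hq.le) hβ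
  (hmax.2 hs).antisymm (meanFieldRoots_le_of_log_lt hq hβ hs hlog hmax.1)

lemma sBeta_betaC (hq : 2 < q) : sBeta q (betaC q) = 2 * inflection q := by
  refine (eq_sBeta_of_log_lt hq le_rfl (two_mul_inflection_mem_meanFieldRoots hq) ?_).symm
  rw [mul_left_comm, betaC_mul_inflection hq]
  linarith [log_sub_one_pos hq]

lemma betaC_lt (hq : 2 < q) : betaC q < q := by
  have hr : (1 : ℝ) < q := by exact_mod_cast one_lt_two.trans hq
  have h := (strictConvexOn_magnetization hr).deriv_lt_slope (log_sub_one_pos hq).le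
    Set.self_mem_Iic (log_sub_one_pos hq) (hasDerivAt_magnetization hr.le 0).differentiableAt
  simp only [(hasDerivAt_magnetization hr.le 0).deriv, slope_def_field, magnetization_zero,
    magnetization_log hr, inflection_eq hq, sub_zero, mul_zero, add_zero, mul_one,
    mul_div_cancel_right₀ _ (log_sub_one_pos hq).ne', one_div] at h
  exact (inv_lt_inv₀ (by linarith) (betaC_pos hq)).1 h

end CriticalTemperature

/-! ### Minimizers of the mean-field energy -/

section Determinant

open Matrix

variable {ι : Type*} [Fintype ι] [DecidableEq ι]

lemma det_diagonal_add_vecMulVec_of_ne_zero {d : ι → ℝ} (hd : ∀ i, d i ≠ 0) (u v : ι → ℝ) :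
    (diagonal d + vecMulVec u v).det =
      ∏ i, d i + ∑ i, u i * v i * ∏ j ∈ Finset.univ.erase i, d j := by
  have hfactor : diagonal d + vecMulVec u v = diagonal d * (1 + vecMulVec (u / d) v) := by
    rw [mul_add, mul_one, mul_vecMulVec]
    congr 2
    funext i
    rw [mulVec_diagonal, Pi.div_apply, mul_div_cancel₀ _ (hd i)]
  rw [hfactor, det_mul, det_diagonal, vecMulVec_eq Unit, det_one_add_replicateCol_mul_replicateRow,
    mul_add, mul_one, dotProduct, Finset.mul_sum]
  congr 1
  refine Finset.sum_congr rfl fun i _ => ?_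
  rw [← Finset.mul_prod_erase _ _ (Finset.mem_univ i), Pi.div_apply]
  field_simp [hd i]

/-- The matrix determinant lemma, extended by density to singular diagonals. -/
lemma det_diagonal_add_vecMulVec (d u v : ι → ℝ) : (diagonal d + vecMulVec u v).det =
    ∏ i, d i + ∑ i, u i * v i * ∏ j ∈ Finset.univ.erase i, d j := by
  have hdense : Dense (Set.univ.pi fun _ : ι => ({0}ᶜ : Set ℝ)) :=
    dense_pi _ fun _ _ => dense_compl_singleton 0
  exact congrFun (Continuous.ext_on hdense (f := fun d => (diagonal d + vecMulVec u v).det)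
    (by fun_prop) (by fun_prop) fun d hd =>
      det_diagonal_add_vecMulVec_of_ne_zero (fun i => hd i trivial) u v) d

lemma det_hessian (β : ℝ) {p : ι → ℝ} (hp : ∑ i, p i = 1) : (hessian β p).det =
    ∑ i, β * p i * ∏ j ∈ Finset.univ.erase i, β * (1 - β * p j) := by
  have hdecomp : hessian β p =
      diagonal (fun i => β * (1 - β * p i)) + vecMulVec (β • p) (β • p) := by
    ext i j
    rcases eq_or_ne i j with rfl | hij
    · simp only [hessian, Matrix.sub_apply, Matrix.smul_apply, one_apply_eq, diagonal_apply_eq,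
        vecMulVec_apply, Matrix.add_apply, Pi.smul_apply, smul_eq_mul]
      ring
    · simp only [hessian, Matrix.sub_apply, Matrix.smul_apply, one_apply_ne hij,
        diagonal_apply_ne _ hij, vecMulVec_apply, Matrix.add_apply, Pi.smul_apply, smul_eq_mul]
      ring
  have hprod : ∏ i, β * (1 - β * p i) = ∑ i, p i * ∏ j, β * (1 - β * p j) := by
    rw [← Finset.sum_mul, hp, one_mul]
  rw [hdecomp, det_diagonal_add_vecMulVec, hprod, ← Finset.sum_add_distrib]
  refine Finset.sum_congr rfl fun i _ => ?_
  rw [← Finset.mul_prod_erase _ _ (Finset.mem_univ i), Pi.smul_apply, smul_eq_mul]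
  ring

lemma det_hessian_of_eq_off {q : ℕ} {p : Fin q → ℝ} {k : Fin q} {b : ℝ} (β : ℝ) (hq : 2 ≤ q)
    (hp : ∑ i, p i = 1) (hb : ∀ i ≠ k, p i = b) :
    (hessian β p).det = β ^ q * (1 - β * b) ^ (q - 2) * (1 - β * (q * p k * b)) := by
  obtain ⟨m, rfl⟩ := Nat.exists_eq_add_of_le' hq
  have hcard : (Finset.univ.erase k).card = m + 1 := by
    rw [Finset.card_erase_of_mem (Finset.mem_univ k), Finset.card_univ, Fintype.card_fin]
    rfl
  have hself : ∏ j ∈ Finset.univ.erase k, β * (1 - β * p j) = (β * (1 - β * b)) ^ (m + 1) := by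
    rw [Finset.prod_congr rfl fun j hj => by rw [hb j (Finset.ne_of_mem_erase hj)],
      Finset.prod_const, hcard]
  have hother (i : Fin (m + 2)) (hi : i ≠ k) : ∏ j ∈ Finset.univ.erase i, β * (1 - β * p j) =
      β * (1 - β * p k) * (β * (1 - β * b)) ^ m := by
    have hmem : i ∈ Finset.univ.erase k := Finset.mem_erase.2 ⟨hi, Finset.mem_univ i⟩
    rw [← Finset.mul_prod_erase _ _ (Finset.mem_erase.2 ⟨hi.symm, Finset.mem_univ k⟩),
      Finset.erase_right_comm, Finset.prod_congr rfl fun j hj => by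
        rw [hb j (Finset.ne_of_mem_erase (Finset.mem_of_mem_erase hj))],
      Finset.prod_const, Finset.card_erase_of_mem hmem, hcard, Nat.add_sub_cancel]
  have hsum : p k + (m + 1) * b = 1 := by
    rw [← Finset.add_sum_erase _ _ (Finset.mem_univ k),
      Finset.sum_congr rfl fun i hi => hb i (Finset.ne_of_mem_erase hi), Finset.sum_const, hcard,
      nsmul_eq_mul, Nat.cast_succ] at hp
    exact hp
  rw [det_hessian β hp, ← Finset.add_sum_erase _ _ (Finset.mem_univ k), hself,
    Finset.sum_congr rfl fun i hi => by
      rw [hother i (Finset.ne_of_mem_erase hi), hb i (Finset.ne_of_mem_erase hi)],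
    Finset.sum_const, hcard, nsmul_eq_mul, Nat.add_sub_cancel, mul_pow, mul_pow]
  push_cast
  linear_combination β ^ (m + 2) * (1 - β * b) ^ m * hsum

end Determinant

section OrderPoint

open Matrix

variable {q : ℕ} {β s t x : ℝ} {k l : Fin q} {y : Fin q → ℝ}

/-- The mean-field energy of `orderPoint k s`, up to an additive constant and a positive factor
that do not depend on `k` and `s`. -/
def orderEnergy (q : ℕ) (β s : ℝ) : ℝ := β / 2 * s ^ 2 - cumulant q (β * s)

/-- The letter distribution with magnetization `s` in the direction of the letter `k`. -/
def orderPoint (k : Fin q) (s : ℝ) : Fin q → ℝ := (fun _ => (1 - s) / q) + Pi.single k s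

lemma orderPoint_apply_self (k : Fin q) (s : ℝ) :
    orderPoint k s k = (1 + ((q : ℝ) - 1) * s) / q := by
  have hq0 : (q : ℝ) ≠ 0 := by exact_mod_cast k.pos.ne'
  rw [orderPoint, Pi.add_apply, Pi.single_eq_same]
  field_simp
  ring

lemma orderPoint_apply_of_ne (h : l ≠ k) (s : ℝ) : orderPoint k s l = (1 - s) / q := by
  rw [orderPoint, Pi.add_apply, Pi.single_eq_of_ne h, add_zero]

lemma orderPoint_zero (k : Fin q) : orderPoint k 0 = fun _ => 1 / (q : ℝ) := by
  rw [orderPoint, Pi.single_zero, add_zero, sub_zero]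

lemma orderPoint_injective (hs : s ≠ 0) : (fun k : Fin q => orderPoint k s).Injective := by
  intro k l hkl
  have hsingle : (Pi.single k s : Fin q → ℝ) = Pi.single l s := add_left_cancel hkl
  by_contra hne
  have hk := congrFun hsingle k
  rw [Pi.single_eq_same, Pi.single_eq_of_ne hne] at hk
  exact hs hk

lemma sum_comp_orderPoint (k : Fin q) (s : ℝ) (φ : ℝ → ℝ) : ∑ i, φ (orderPoint k s i) =
    φ ((1 + ((q : ℝ) - 1) * s) / q) + ((q : ℝ) - 1) * φ ((1 - s) / q) := by
  rw [← Finset.add_sum_erase _ _ (Finset.mem_univ k), orderPoint_apply_self,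
    Finset.sum_congr rfl fun i hi => by rw [orderPoint_apply_of_ne (Finset.ne_of_mem_erase hi)],
    Finset.sum_const, Finset.card_erase_of_mem (Finset.mem_univ k), Finset.card_univ,
    Fintype.card_fin, nsmul_eq_mul, Nat.cast_pred k.pos]

lemma sum_orderPoint (k : Fin q) (s : ℝ) : ∑ i, orderPoint k s i = 1 := by
  have hq0 : (q : ℝ) ≠ 0 := by exact_mod_cast k.pos.ne'
  refine (sum_comp_orderPoint k s id).trans ?_
  simp only [id]
  field_simp
  ring

lemma expSum_const_add (a : ℝ) (c : Fin q → ℝ) :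
    expSum ((fun _ => a) + c) = Real.exp a * expSum c := by
  simp only [expSum, Finset.mul_sum, Pi.add_apply, Real.exp_add]

lemma softmax_const_add (a : ℝ) (c : Fin q → ℝ) : softmax ((fun _ => a) + c) = softmax c := by
  funext i
  rw [softmax, expSum_const_add, Pi.add_apply, Real.exp_add,
    mul_div_mul_left _ _ (Real.exp_pos a).ne', softmax]

lemma expSum_single (k : Fin q) (x : ℝ) :
    expSum (Pi.single k x : Fin q → ℝ) = Real.exp x + q - 1 := by
  rw [expSum, ← Finset.add_sum_erase _ _ (Finset.mem_univ k), Pi.single_eq_same,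
    Finset.sum_congr rfl fun i hi => by
      rw [Pi.single_eq_of_ne (Finset.ne_of_mem_erase hi), Real.exp_zero],
    Finset.sum_const, Finset.card_erase_of_mem (Finset.mem_univ k), Finset.card_univ,
    Fintype.card_fin, nsmul_one, Nat.cast_pred k.pos, add_sub_assoc]

lemma softmax_single (k : Fin q) (x : ℝ) :
    softmax (Pi.single k x) = orderPoint k (magnetization q x) := by
  have hq0 : (q : ℝ) ≠ 0 := by exact_mod_cast k.pos.ne'
  have hpos := exp_add_sub_one_pos (r := q) (by exact_mod_cast k.pos) x
  funext i
  rw [softmax, expSum_single]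
  rcases eq_or_ne i k with rfl | hik
  · rw [Pi.single_eq_same, orderPoint_apply_self, magnetization]
    field_simp
    ring
  · rw [Pi.single_eq_of_ne hik, orderPoint_apply_of_ne hik, magnetization, Real.exp_zero]
    field_simp
    ring

lemma smul_orderPoint (β : ℝ) (k : Fin q) (s : ℝ) :
    β • orderPoint k s = (fun _ => β * ((1 - s) / q)) + Pi.single k (β * s) := by
  rw [orderPoint, smul_add, ← Pi.single_smul, smul_eq_mul]
  rfl

lemma mfEnergy_orderPoint (hq : 1 < q) (β : ℝ) (k : Fin q) (s : ℝ) : mfEnergy β (orderPoint k s) =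
    ((q : ℝ) - 1) / q * orderEnergy q β s - (β / (2 * q) + Real.log q) := by
  have hr : (0 : ℝ) < q - 1 := sub_pos.2 (by exact_mod_cast hq)
  have hpos := exp_add_sub_one_pos (sub_pos.1 hr).le (β * s)
  have hsq : orderPoint k s ⬝ᵥ orderPoint k s = (1 + ((q : ℝ) - 1) * s ^ 2) / q := by
    refine (sum_comp_orderPoint k s fun z => z * z).trans ?_
    field_simp
    ring
  have hcum : ((q : ℝ) - 1) / q * cumulant q (β * s) =
      Real.log (Real.exp (β * s) + q - 1) - Real.log q - β * s / q := by
    rw [cumulant, Real.log_div hpos.ne' (by positivity)]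
    field_simp
  rw [mfEnergy, orderEnergy, hsq, smul_orderPoint, expSum_const_add, expSum_single,
    Real.log_mul (Real.exp_pos _).ne' hpos.ne', Real.log_exp, mul_sub, hcum]
  field_simp
  ring

lemma mfEnergy_orderPoint_le_iff (hq : 1 < q) :
    mfEnergy β (orderPoint k s) ≤ mfEnergy β (orderPoint l t) ↔
      orderEnergy q β s ≤ orderEnergy q β t := by
  have hr : (1 : ℝ) < q := by exact_mod_cast hq
  rw [mfEnergy_orderPoint hq, mfEnergy_orderPoint hq, sub_le_sub_iff_right]
  exact mul_le_mul_iff_of_pos_left (div_pos (by linarith) (by linarith))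

lemma det_hessian_orderPoint (β : ℝ) (k : Fin q) (s : ℝ) (hq : 2 ≤ q) :
    (hessian β (orderPoint k s)).det = β ^ q * (1 - β * ((1 - s) / q)) ^ (q - 2) *
      (1 - β * ((1 + ((q : ℝ) - 1) * s) * (1 - s) / q)) := by
  have hab : (1 + ((q : ℝ) - 1) * s) * (1 - s) / q = q * orderPoint k s k * ((1 - s) / q) := by
    have hq0 : (q : ℝ) ≠ 0 := by exact_mod_cast k.pos.ne'
    rw [orderPoint_apply_self]
    field_simp
  rw [det_hessian_of_eq_off β hq (sum_orderPoint k s) fun i hi => orderPoint_apply_of_ne hi s, hab]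

end OrderPoint

section Minimizers

open Matrix

variable {ι : Type*} [Fintype ι] {β : ℝ} {y : ι → ℝ} {i j k : ι}

lemma mul_le_one_of_mem_minimizers (hβ : 0 < β) (hy : y ∈ minimizers ι β)
    (hik : i ≠ k) (h : y i = y k) : β * y k ≤ 1 := by
  classical
  have : Nonempty ι := ⟨k⟩
  set z : ι → ℝ := Pi.single i 1 - Pi.single k 1 with hz
  have hsq : z ⬝ᵥ z = 2 := by
    simp [hz, hik, hik.symm, one_add_one_eq_two]
  have hvar : ∑ l, y l * z l ^ 2 = 2 * y k := by
    have hmul (l : ι) : y l * z l ^ 2 = y l * (Pi.single i 1 : ι → ℝ) l +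
        y l * (Pi.single k 1 : ι → ℝ) l := by
      by_cases hi : l = i <;> by_cases hk : l = k <;> simp_all
    simp [hmul, Finset.sum_add_distrib, Pi.single_apply, h, two_mul]
  have hmean : y ⬝ᵥ z = 0 := by simp [hz, dotProduct_sub, h]
  have hnonneg := (posSemidef_hessian hβ hy).dotProduct_mulVec_nonneg z
  rw [star_trivial, dotProduct_hessian_mulVec, hsq, hvar, hmean] at hnonneg
  have hprod : 0 ≤ 2 * β * (1 - β * y k) := by linarith
  exact sub_nonneg.1 (nonneg_of_mul_nonneg_right hprod (by positivity))

lemma pos_of_mem_minimizers (hβ : 0 < β) (hy : y ∈ minimizers ι β) (i : ι) : 0 < y i := by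
  have : Nonempty ι := ⟨i⟩
  rw [← softmax_eq_of_mem_minimizers hβ hy]
  exact softmax_pos _ i

lemma slope_log_of_mem_minimizers (hβ : 0 < β) (hy : y ∈ minimizers ι β) (h : y i ≠ y j) :
    slope Real.log (y i) (y j) = β := by
  have : Nonempty ι := ⟨i⟩
  have hlog (l : ι) : Real.log (y l) = β * y l - Real.log (expSum (β • y)) := by
    have hneg := neg_log_softmax (β • y) l
    rw [softmax_eq_of_mem_minimizers hβ hy, Pi.smul_apply, smul_eq_mul] at hneg
    linarith
  rw [slope_def_field, div_eq_iff (sub_ne_zero.2 h.symm), hlog, hlog]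
  ring

lemma eq_of_mem_minimizers (hβ : 0 < β) (hy : y ∈ minimizers ι β) (hk : ∀ l, y l ≤ y k)
    (hi : i ≠ k) (hj : j ≠ k) : y i = y j := by
  wlog hij : y i ≤ y j generalizing i j
  · exact (this hj hi (le_of_not_ge hij)).symm
  by_contra hne
  have hlt := hij.lt_of_ne hne
  have hpos := pos_of_mem_minimizers hβ hy
  rcases (hk j).eq_or_lt with hjk | hjk
  · have hslope := strictConcaveOn_log_Ioi.deriv_lt_slope (hpos i) (hpos j) hlt
      (Real.differentiableAt_log (hpos j).ne')
    rw [slope_log_of_mem_minimizers hβ hy hne, Real.deriv_log, inv_lt_iff_one_lt_mul₀ (hpos j),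
      hjk] at hslope
    exact hslope.not_ge (mul_le_one_of_mem_minimizers hβ hy hj hjk)
  · have hslope := strictConcaveOn_log_Ioi.slope_anti_adjacent (hpos i) (hpos k) hlt hjk
    rw [← slope_def_field, ← slope_def_field, slope_log_of_mem_minimizers hβ hy hne,
      slope_log_of_mem_minimizers hβ hy hjk.ne] at hslope
    exact hslope.false

end Minimizers

section OrderedMinimizers

variable {q : ℕ} {β s : ℝ} {y : Fin q → ℝ}

lemma exists_orderPoint_of_mem_minimizers (hq : 2 ≤ q) (hβ : 0 < β)
    (hy : y ∈ minimizers (Fin q) β) :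
    ∃ k, ∃ s ∈ meanFieldRoots q β, 0 ≤ s ∧ y = orderPoint k s := by
  have : Nontrivial (Fin q) := Fin.nontrivial_iff_two_le.2 hq
  obtain ⟨k, hk⟩ := Finite.exists_max y
  obtain ⟨l, hl⟩ := exists_ne k
  have hfix := softmax_eq_of_mem_minimizers hβ hy
  have hshift : y = (fun _ => y l) + Pi.single k (y k - y l) := by
    funext i
    rcases eq_or_ne i k with rfl | hi
    · simp
    · simp [hi, eq_of_mem_minimizers hβ hy hk hi hl]
  have hsoft : softmax (β • y) = orderPoint k (magnetization q (β * (y k - y l))) := by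
    conv_lhs => rw [hshift]
    rw [smul_add, ← Pi.single_smul, smul_eq_mul]
    exact (softmax_const_add _ _).trans (softmax_single k _)
  have hy_eq : y = orderPoint k (magnetization q (β * (y k - y l))) := hfix.symm.trans hsoft
  have hs : y k - y l = magnetization q (β * (y k - y l)) := by
    conv_lhs => rw [hy_eq]
    simp [orderPoint, hl]
  exact ⟨k, y k - y l, hs, sub_nonneg.2 (hk l), hs ▸ hy_eq⟩

lemma orderPoint_mem_minimizers (hq : 2 ≤ q) (hβ : 0 < β) (k : Fin q) :
    orderPoint k s ∈ minimizers (Fin q) β ↔ ∀ t, orderEnergy q β s ≤ orderEnergy q β t := by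
  refine ⟨fun h t => (mfEnergy_orderPoint_le_iff hq).1 (h (orderPoint k t)), fun h z => ?_⟩
  have : Nonempty (Fin q) := ⟨k⟩
  obtain ⟨y, hy⟩ := minimizers_nonempty (ι := Fin q) hβ
  obtain ⟨l, t, -, -, rfl⟩ := exists_orderPoint_of_mem_minimizers hq hβ hy
  exact ((mfEnergy_orderPoint_le_iff hq).2 (h t)).trans (hy z)

lemma orderEnergy_zero (hq : q ≠ 0) (β : ℝ) : orderEnergy q β 0 = 0 := by
  rw [orderEnergy, mul_zero, cumulant_zero (Nat.cast_ne_zero.2 hq)]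
  ring

lemma orderEnergy_eq_add (q : ℕ) (β s : ℝ) : orderEnergy q β s =
    β / 2 * (1 - β * (betaC q)⁻¹) * s ^ 2 +
      ((betaC q)⁻¹ / 2 * (β * s) ^ 2 - cumulant q (β * s)) := by
  rw [orderEnergy]
  ring

lemma orderEnergy_betaC (hq : 2 < q) (s : ℝ) : orderEnergy q (betaC q) s =
    (betaC q)⁻¹ / 2 * (betaC q * s) ^ 2 - cumulant q (betaC q * s) := by
  rw [orderEnergy_eq_add, mul_inv_cancel₀ (betaC_pos hq).ne']
  ring

lemma minimizers_of_lt_betaC (hq : 2 < q) (hβ : 0 < β) (hlt : β < betaC q) :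
    minimizers (Fin q) β = {fun _ => 1 / (q : ℝ)} := by
  have : NeZero q := ⟨by omega⟩
  refine (minimizers_nonempty hβ).subset_singleton_iff.1 fun y hy => ?_
  obtain ⟨k, s, -, -, rfl⟩ := exists_orderPoint_of_mem_minimizers hq.le hβ hy
  suffices hs : s = 0 by rw [hs, orderPoint_zero, Set.mem_singleton_iff]
  by_contra hs
  have hle := (orderPoint_mem_minimizers hq.le hβ k).1 hy 0
  have hratio : 0 < 1 - β * (betaC q)⁻¹ :=
    sub_pos.2 ((mul_inv_lt_iff₀ (betaC_pos hq)).2 (by rwa [one_mul]))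
  have hpos : 0 < β / 2 * (1 - β * (betaC q)⁻¹) * s ^ 2 := by positivity
  rw [orderEnergy_zero (by omega), orderEnergy_eq_add] at hle
  linarith [cumulant_le hq (β * s)]

lemma orderEnergy_two_mul_log_div_neg (hq : 2 < q) (hlt : betaC q < β) :
    orderEnergy q β (2 * Real.log ((q : ℝ) - 1) / β) < 0 := by
  have hβ := (betaC_pos hq).trans hlt
  have hlog := log_sub_one_pos hq
  have hratio : 1 - β * (betaC q)⁻¹ < 0 :=
    sub_neg.2 ((lt_mul_inv_iff₀ (betaC_pos hq)).2 (by rwa [one_mul]))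
  rw [orderEnergy_eq_add, mul_div_cancel₀ _ hβ.ne', cumulant_two_mul_log hq, sub_self, add_zero]
  exact mul_neg_of_neg_of_pos (mul_neg_of_pos_of_neg (by positivity) hratio) (by positivity)

lemma log_lt_of_orderEnergy_neg (hq : 2 < q) (hβ : 0 < β) (hroot : s ∈ meanFieldRoots q β)
    (hs0 : 0 ≤ s) (hneg : orderEnergy q β s < 0) : Real.log ((q : ℝ) - 1) < β * s := by
  have hpos : 0 < β * s := mul_pos hβ <| hs0.lt_of_ne' fun h => by
    rw [h, orderEnergy_zero (by omega)] at hneg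
    exact hneg.false
  have hfix : magnetization q (β * s) = β⁻¹ * (β * s) := by
    rw [← mem_meanFieldRoots.1 hroot, inv_mul_cancel_left₀ hβ.ne']
  refine lt_of_not_ge fun hle => hneg.not_gt ?_
  have hcum := cumulant_lt_of_magnetization_le (by exact_mod_cast one_lt_two.trans hq) hpos hle
    hfix.le le_rfl hpos.ne'
  rw [show β⁻¹ / 2 * (β * s) ^ 2 = β / 2 * s ^ 2 by field_simp] at hcum
  exact sub_pos.2 hcum

lemma eq_sBeta_of_orderPoint_mem_minimizers (hq : 2 < q) (hlt : betaC q < β) {k : Fin q}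
    (hroot : s ∈ meanFieldRoots q β) (hs0 : 0 ≤ s)
    (hs : orderPoint k s ∈ minimizers (Fin q) β) : s = sBeta q β := by
  have hβ := (betaC_pos hq).trans hlt
  have hneg : orderEnergy q β s < 0 :=
    ((orderPoint_mem_minimizers hq.le hβ k).1 hs _).trans_lt
      (orderEnergy_two_mul_log_div_neg hq hlt)
  exact eq_sBeta_of_log_lt hq hlt.le hroot (log_lt_of_orderEnergy_neg hq hβ hroot hs0 hneg)

lemma minimizers_of_betaC_lt (hq : 2 < q) (hlt : betaC q < β) :
    minimizers (Fin q) β = Set.range fun k => orderPoint k (sBeta q β) := by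
  have : NeZero q := ⟨by omega⟩
  have hβ := (betaC_pos hq).trans hlt
  have hsub (y : Fin q → ℝ) (hy : y ∈ minimizers (Fin q) β) :
      ∃ k, orderPoint k (sBeta q β) = y := by
    obtain ⟨k, s, hroot, hs0, rfl⟩ := exists_orderPoint_of_mem_minimizers hq.le hβ hy
    exact ⟨k, by rw [eq_sBeta_of_orderPoint_mem_minimizers hq hlt hroot hs0 hy]⟩
  refine Set.Subset.antisymm hsub (Set.range_subset_iff.2 fun k => ?_)
  obtain ⟨y, hy⟩ := minimizers_nonempty (ι := Fin q) hβ
  obtain ⟨l, rfl⟩ := hsub y hy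
  rwa [orderPoint_mem_minimizers hq.le hβ] at hy ⊢

lemma orderPoint_mem_minimizers_betaC (hq : 2 < q) (k : Fin q) :
    orderPoint k s ∈ minimizers (Fin q) (betaC q) ↔ s = 0 ∨ s = sBeta q (betaC q) := by
  have hβ := betaC_pos hq
  have hnonneg (t : ℝ) : 0 ≤ orderEnergy q (betaC q) t := by
    rw [orderEnergy_betaC hq]
    exact sub_nonneg.2 (cumulant_le hq _)
  have hzero : orderEnergy q (betaC q) 0 = 0 := orderEnergy_zero (by omega) _
  have hroot : betaC q * sBeta q (betaC q) = 2 * Real.log ((q : ℝ) - 1) := by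
    rw [sBeta_betaC hq, mul_left_comm, betaC_mul_inflection hq]
  rw [orderPoint_mem_minimizers hq.le hβ]
  refine ⟨fun h => ?_, ?_⟩
  · by_contra! hne
    have hlt := cumulant_lt_of_ne hq (mul_ne_zero hβ.ne' hne.1)
      (hroot ▸ (mul_right_injective₀ hβ.ne').ne hne.2)
    exact (sub_pos.2 hlt).not_ge (orderEnergy_betaC hq s ▸ hzero ▸ h 0)
  · rintro (rfl | rfl) t
    · exact hzero.trans_le (hnonneg t)
    · rw [orderEnergy_betaC hq, hroot, cumulant_two_mul_log hq, sub_self]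
      exact hnonneg t

lemma minimizers_betaC (hq : 2 < q) : minimizers (Fin q) (betaC q) =
    insert (fun _ => 1 / (q : ℝ)) (Set.range fun k => orderPoint k (sBeta q (betaC q))) := by
  have : NeZero q := ⟨by omega⟩
  ext y
  refine ⟨fun hy => ?_, ?_⟩
  · obtain ⟨k, s, -, -, rfl⟩ := exists_orderPoint_of_mem_minimizers hq.le (betaC_pos hq) hy
    rcases (orderPoint_mem_minimizers_betaC hq k).1 hy with rfl | rfl
    · exact .inl (orderPoint_zero k)
    · exact .inr ⟨k, rfl⟩
  · rintro (rfl | ⟨k, rfl⟩)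
    · exact orderPoint_zero (0 : Fin q) ▸ (orderPoint_mem_minimizers_betaC hq 0).2 (.inl rfl)
    · exact (orderPoint_mem_minimizers_betaC hq k).2 (.inr rfl)

end OrderedMinimizers

/-! ### The Hubbard–Stratonovich transformation -/

section Hubbard

open Matrix

variable {q m l n : ℕ} {β : ℝ}

/-- The vector of the numbers of occurrences of the letters in a word. -/
def letterCount (w : Fin n → Fin q) : Fin q → ℝ := ∑ i, Pi.single (w i) 1

lemma letterCount_dotProduct (w : Fin n → Fin q) (y : Fin q → ℝ) :
    letterCount w ⬝ᵥ y = ∑ i, y (w i) := by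
  simp only [letterCount, sum_dotProduct, single_one_dotProduct]

lemma hamiltonian_eq (w : Fin n → Fin q) :
    hamiltonian w = -(1 / (2 * (n : ℝ))) * (letterCount w ⬝ᵥ letterCount w) := by
  rw [hamiltonian, letterCount_dotProduct]
  simp only [letterCount, Finset.sum_apply, Pi.single_apply, eq_comm (a := w _) (b := w _)]

/-- The joint weight of a word and a field in the Hubbard–Stratonovich transformation: integrating
out the field gives the Gibbs weight of the word, and given the field the letters are
independent. -/
def fieldWeight (β : ℝ) (w : Fin n → Fin q) (y : Fin q → ℝ) : ℝ :=
  Real.exp (-(n * β / 2 * (y ⬝ᵥ y)) + β * (letterCount w ⬝ᵥ y))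

lemma fieldWeight_eq (hn : n ≠ 0) (w : Fin n → Fin q) (y : Fin q → ℝ) :
    fieldWeight β w y = Real.exp (-β * hamiltonian w) * Real.exp (-(n * β / 2 *
      ((y - (n : ℝ)⁻¹ • letterCount w) ⬝ᵥ (y - (n : ℝ)⁻¹ • letterCount w)))) := by
  have hn0 : (n : ℝ) ≠ 0 := by exact_mod_cast hn
  rw [fieldWeight, ← Real.exp_add, hamiltonian_eq]
  congr 1
  simp only [sub_dotProduct, dotProduct_sub, smul_dotProduct, dotProduct_smul, smul_eq_mul,
    dotProduct_comm y (letterCount w)]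
  field_simp
  ring

lemma integrable_fieldWeight (hβ : 0 < β) (hn : n ≠ 0) (w : Fin n → Fin q) :
    Integrable (fieldWeight β w) := by
  have hb : 0 < n * β / 2 := by positivity
  rw [funext (fieldWeight_eq hn w)]
  exact ((integrable_exp_neg_mul_dotProduct_self hb).comp_sub_right _).const_mul _

lemma integral_fieldWeight (hn : n ≠ 0) (w : Fin n → Fin q) :
    ∫ y, fieldWeight β w y = Real.exp (-β * hamiltonian w) *
      ∫ y : Fin q → ℝ, Real.exp (-(n * β / 2 * (y ⬝ᵥ y))) := by
  simp_rw [fieldWeight_eq hn w]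
  rw [integral_const_mul, integral_sub_right_eq_self
    fun y : Fin q → ℝ => Real.exp (-(n * β / 2 * (y ⬝ᵥ y)))]

lemma fieldWeight_eq_prod [NeZero q] (w : Fin n → Fin q) (y : Fin q → ℝ) : fieldWeight β w y =
    (∏ i, softmax (β • y) (w i)) * Real.exp (-(n * mfEnergy β y)) := by
  have hE := expSum_pos (β • y)
  have hprod : ∏ i, softmax (β • y) (w i) =
      Real.exp (β * (letterCount w ⬝ᵥ y)) / expSum (β • y) ^ n := by
    simp only [softmax, Finset.prod_div_distrib, ← Real.exp_sum, Pi.smul_apply, smul_eq_mul,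
      ← Finset.mul_sum, ← letterCount_dotProduct, Finset.prod_const, Finset.card_univ,
      Fintype.card_fin]
  have henergy : Real.exp (-(n * mfEnergy β y)) =
      Real.exp (-(n * β / 2 * (y ⬝ᵥ y))) * expSum (β • y) ^ n := by
    rw [← Real.exp_log (pow_pos hE n), ← Real.exp_add, Real.log_pow, mfEnergy]
    congr 1
    ring
  rw [hprod, henergy, fieldWeight, Real.exp_add]
  field_simp

lemma sum_fieldWeight_append [NeZero q] (u : Fin m → Fin q) (y : Fin q → ℝ) :
    ∑ v : Fin l → Fin q, fieldWeight β (Fin.append u v) y =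
      (∏ i, softmax (β • y) (u i)) * Real.exp (-((m + l : ℕ) * mfEnergy β y)) := by
  simp only [fieldWeight_eq_prod, Fin.prod_univ_add, Fin.append_left, Fin.append_right,
    ← Finset.sum_mul, ← Finset.mul_sum]
  rw [sum_prod_letter (sum_softmax _), mul_one]

lemma sum_exp_hamiltonian_append [NeZero q] (hβ : 0 < β) (hml : m + l ≠ 0) (u : Fin m → Fin q) :
    (∑ v : Fin l → Fin q, Real.exp (-β * hamiltonian (Fin.append u v))) *
      (∫ y : Fin q → ℝ, Real.exp (-((m + l : ℕ) * β / 2 * (y ⬝ᵥ y)))) =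
      ∫ y, (∏ i, softmax (β • y) (u i)) * Real.exp (-((m + l : ℕ) * mfEnergy β y)) := by
  simp only [← sum_fieldWeight_append]
  rw [integral_finsetSum _ fun v _ => integrable_fieldWeight hβ hml _, Finset.sum_mul]
  exact Finset.sum_congr rfl fun v _ => (integral_fieldWeight hml _).symm

lemma sum_exp_hamiltonian [NeZero q] (hβ : 0 < β) (hn : n ≠ 0) :
    (∑ w : Fin n → Fin q, Real.exp (-β * hamiltonian w)) *
      (∫ y : Fin q → ℝ, Real.exp (-(n * β / 2 * (y ⬝ᵥ y)))) =
      ∫ y : Fin q → ℝ, Real.exp (-(n * mfEnergy β y)) := by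
  simp only [Finset.sum_mul, ← integral_fieldWeight hn]
  rw [← integral_finsetSum _ fun w _ => integrable_fieldWeight hβ hn w]
  simp only [fieldWeight_eq_prod, ← Finset.sum_mul, sum_prod_letter (sum_softmax _), one_mul]

end Hubbard

section GibbsWords

variable {q m l n : ℕ} {β : ℝ}

lemma measure_word_eq_sum_append (μ : Measure (Shift q)) (u : Fin m → Fin q) :
    μ (word m ⁻¹' {u}) = ∑ v : Fin l → Fin q, μ (word (m + l) ⁻¹' {Fin.append u v}) := by
  have hunion : word m ⁻¹' {u} = ⋃ v : Fin l → Fin q, word (m + l) ⁻¹' {Fin.append u v} := by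
    ext x
    have hx : word (m + l) x = Fin.append (word m x) fun j => x (m + j) :=
      (Fin.append_castAdd_natAdd (f := word (m + l) x)).symm
    simp only [Set.mem_preimage, Set.mem_singleton_iff, Set.mem_iUnion, hx]
    refine ⟨fun h => ⟨_, by rw [h]⟩, fun ⟨v, hv⟩ => funext fun i => ?_⟩
    simpa only [Fin.append_left] using congrFun hv (Fin.castAdd l i)
  rw [hunion, measure_iUnion (fun v w hvw => ?_) fun v =>
    measurable_word _ (measurableSet_singleton _), tsum_fintype]
  refine Disjoint.preimage _ (Set.disjoint_singleton.2 fun h => hvw ?_)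
  exact congrArg Prod.snd ((Fin.appendEquiv m l).injective (a₁ := (u, v)) (a₂ := (u, w)) h)

lemma uniformBernoulli_word [NeZero q] (w : Fin n → Fin q) :
    uniformBernoulli q (word n ⁻¹' {w}) = ENNReal.ofReal (1 / (q : ℝ) ^ n) := by
  have hp : (fun _ => 1 / (q : ℝ)) ∈ stdSimplex ℝ (Fin q) :=
    ⟨fun _ => by positivity, by simp [NeZero.ne q]⟩
  rw [uniformBernoulli_eq_bernoulli, bernoulli_word hp, Finset.prod_const, Finset.card_univ,
    Fintype.card_fin, one_div_pow]

lemma gibbs_word_self [NeZero q] (w : Fin n → Fin q) : gibbs q n β (word n ⁻¹' {w}) =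
    ENNReal.ofReal (Real.exp (-β * hamiltonian w) /
      ∑ w' : Fin n → Fin q, Real.exp (-β * hamiltonian w')) := by
  have hq : (q : ℝ) ≠ 0 := by exact_mod_cast NeZero.ne q
  have hms := measurable_word (q := q) n (measurableSet_singleton w)
  have hZ : 0 ≤ partitionFunction q n β := by unfold partitionFunction; positivity
  rw [gibbs, withDensity_apply _ hms, setLIntegral_congr_fun hms fun x hx => by
    rw [show (fun i : Fin n => x i) = w from hx], setLIntegral_const, uniformBernoulli_word,
    ← ENNReal.ofReal_mul (by positivity), partitionFunction]
  congr 1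
  field_simp

lemma isProbabilityMeasure_gibbs [NeZero q] (n : ℕ) (β : ℝ) :
    IsProbabilityMeasure (gibbs q n β) := by
  constructor
  rw [← Set.preimage_univ (f := word n), measure_preimage_word, Set.Finite.toFinset_univ]
  simp only [gibbs_word_self]
  rw [← ENNReal.ofReal_sum_of_nonneg fun w _ => by positivity, ← Finset.sum_div, div_self,
    ENNReal.ofReal_one]
  exact (Finset.sum_pos (fun w _ => Real.exp_pos _) Finset.univ_nonempty).ne'

lemma gibbs_word [NeZero q] (u : Fin m → Fin q) : gibbs q (m + l) β (word m ⁻¹' {u}) =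
    ENNReal.ofReal ((∑ v : Fin l → Fin q, Real.exp (-β * hamiltonian (Fin.append u v))) /
      ∑ w : Fin (m + l) → Fin q, Real.exp (-β * hamiltonian w)) := by
  rw [measure_word_eq_sum_append (l := l), Finset.sum_div,
    ENNReal.ofReal_sum_of_nonneg fun v _ => by positivity]
  exact Finset.sum_congr rfl fun v _ => gibbs_word_self _

lemma gibbs_word_eq_integral [NeZero q] (hβ : 0 < β) (hmn : m ≤ n) (hn : n ≠ 0) (c : ℝ)
    (u : Fin m → Fin q) : gibbs q n β (word m ⁻¹' {u}) =
      ENNReal.ofReal ((∫ y, (∏ i, softmax (β • y) (u i)) * Real.exp (-(n * (mfEnergy β y - c)))) /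
        ∫ y : Fin q → ℝ, 1 * Real.exp (-(n * (mfEnergy β y - c)))) := by
  obtain ⟨l, rfl⟩ := Nat.exists_eq_add_of_le hmn
  have hpos : 0 < ∫ y : Fin q → ℝ, Real.exp (-((m + l : ℕ) * β / 2 * (y ⬝ᵥ y))) :=
    integral_exp_pos (integrable_exp_neg_mul_dotProduct_self (by positivity))
  have hexp : ∀ y : Fin q → ℝ, Real.exp (-((m + l : ℕ) * (mfEnergy β y - c))) =
      Real.exp (-((m + l : ℕ) * mfEnergy β y)) * Real.exp ((m + l : ℕ) * c) := fun y => by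
    rw [← Real.exp_add]
    congr 1
    ring
  simp only [hexp, one_mul, ← mul_assoc, integral_mul_const]
  rw [gibbs_word, mul_div_mul_right _ _ (Real.exp_pos _).ne', ← sum_exp_hamiltonian_append hβ hn,
    ← sum_exp_hamiltonian hβ hn, mul_div_mul_right _ _ hpos.ne']

end GibbsWords

/-! ### Weak convergence to mixtures of Bernoulli measures -/

section WeakConvergence

variable {q : ℕ}

lemma exists_word_subset {U : Set (Shift q)} (hU : IsOpen U) {x : Shift q} (hx : x ∈ U) :
    ∃ m, word m ⁻¹' {word m x} ⊆ U := by
  obtain ⟨I, t, ht, hsub⟩ := isOpen_pi_iff.1 hU x hx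
  refine ⟨I.sup id + 1, fun z hz => hsub fun i hi => ?_⟩
  have hlt : i < I.sup id + 1 := Nat.lt_succ_of_le (Finset.le_sup (f := id) hi)
  have hzi : z i = x i := congrFun hz ⟨i, hlt⟩
  rw [hzi]
  exact (ht i hi).2

lemma isOpen_preimage_word (m : ℕ) (S : Set (Fin m → Fin q)) : IsOpen (word (q := q) m ⁻¹' S) :=
  (isOpen_discrete S).preimage (f := word m) (continuous_pi fun i => continuous_apply (i : ℕ))

lemma weaklyConverges_of_word {P : ℕ → Measure (Shift q)} {Q : Measure (Shift q)}
    (hP : ∀ n, IsProbabilityMeasure (P n)) (hQ : IsProbabilityMeasure Q)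
    (h : ∀ m u, Tendsto (fun n => P n (word m ⁻¹' {u})) atTop (𝓝 (Q (word m ⁻¹' {u})))) :
    WeaklyConverges P Q := by
  refine ⟨fun n => ⟨P n, hP n⟩, ⟨Q, hQ⟩, fun _ => rfl, rfl, ?_⟩
  refine IsPiSystem.tendsto_probabilityMeasure_of_tendsto_of_mem
    (isPiSystem_measurableCylinders (α := fun _ : ℕ => Fin q))
    (fun s hs => .of_mem_measurableCylinders hs) (fun U hU x hx => ?_) fun s hs => ?_
  · obtain ⟨m, hm⟩ := exists_word_subset hU hx
    exact ⟨_, mem_measurableCylinders_iff.2 ⟨m, {word m x}, rfl⟩,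
      (isOpen_preimage_word m _).mem_nhds rfl, hm⟩
  · obtain ⟨m, S, rfl⟩ := mem_measurableCylinders_iff.1 hs
    have hlim : Tendsto (fun n => P n (word m ⁻¹' S)) atTop (𝓝 (Q (word m ⁻¹' S))) := by
      simp only [measure_preimage_word _ m S]
      exact tendsto_finsetSum _ fun u _ => h m u
    exact (ENNReal.tendsto_toNNReal (measure_ne_top Q _)).comp hlim

variable {κ : Type*} [Fintype κ] {w : κ → ℝ} {p : κ → Fin q → ℝ}

/-- The mixture of the Bernoulli measures with letter weights `p i` in the proportions `w i`. -/
def bernoulliMixture (w : κ → ℝ) (p : κ → Fin q → ℝ) : Measure (Shift q) :=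
  (ENNReal.ofReal (∑ i, w i))⁻¹ • ∑ i, ENNReal.ofReal (w i) • bernoulli (p i)

lemma bernoulliMixture_const_one (p : κ → Fin q → ℝ) : bernoulliMixture (fun _ => 1) p =
    (Fintype.card κ : ℝ≥0∞)⁻¹ • ∑ i, bernoulli (p i) := by
  simp only [bernoulliMixture, Finset.sum_const, Finset.card_univ, nsmul_eq_mul, mul_one,
    ENNReal.ofReal_natCast, ENNReal.ofReal_one, one_smul]

lemma isProbabilityMeasure_bernoulliMixture (hw0 : ∀ i, 0 ≤ w i) (hw : 0 < ∑ i, w i)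
    (hp : ∀ i, p i ∈ stdSimplex ℝ (Fin q)) : IsProbabilityMeasure (bernoulliMixture w p) := by
  have := fun i => (isInvariantProb_bernoulli (hp i)).1
  constructor
  simp only [bernoulliMixture, Measure.smul_apply, Measure.finsetSum_apply, measure_univ,
    smul_eq_mul, mul_one]
  rw [← ENNReal.ofReal_sum_of_nonneg fun i _ => hw0 i,
    ENNReal.inv_mul_cancel (ENNReal.ofReal_pos.2 hw).ne' ENNReal.ofReal_ne_top]

lemma bernoulliMixture_word (hw0 : ∀ i, 0 ≤ w i) (hw : 0 < ∑ i, w i)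
    (hp : ∀ i, p i ∈ stdSimplex ℝ (Fin q)) {m : ℕ} (u : Fin m → Fin q) :
    bernoulliMixture w p (word m ⁻¹' {u}) =
      ENNReal.ofReal ((∑ i, w i * ∏ j, p i (u j)) / ∑ i, w i) := by
  simp only [bernoulliMixture, Measure.smul_apply, Measure.finsetSum_apply, smul_eq_mul,
    bernoulli_word (hp _), ← ENNReal.ofReal_mul (hw0 _)]
  rw [← ENNReal.ofReal_sum_of_nonneg fun i _ =>
      mul_nonneg (hw0 i) (Finset.prod_nonneg fun j _ => (hp i).1 _),
    ENNReal.ofReal_div_of_pos hw, mul_comm, ENNReal.div_eq_inv_mul, mul_comm]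

end WeakConvergence

section LaplaceLimit

variable {κ ι : Type*} [Fintype κ] [Fintype ι] [Nonempty ι] {q : ℕ} {β C K : ℝ} {w : κ → ℝ}

lemma continuous_prod_softmax (β : ℝ) {m : ℕ} (u : Fin m → ι) :
    Continuous fun y : ι → ℝ => ∏ i, softmax (β • y) (u i) := by
  have hne : ∀ y : ι → ℝ, ∑ i, Real.exp (β * y i) ≠ 0 := fun y => (expSum_pos (β • y)).ne'
  simp only [softmax, expSum, Pi.smul_apply, smul_eq_mul]
  fun_prop (disch := exact hne _)

lemma abs_prod_softmax_le_one (c : ι → ℝ) {m : ℕ} (u : Fin m → ι) :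
    |∏ i, softmax c (u i)| ≤ 1 := by
  have hIcc := fun i => mem_Icc_of_mem_stdSimplex (softmax_mem_stdSimplex c) (u i)
  rw [abs_of_nonneg (Finset.prod_nonneg fun i _ => (hIcc i).1)]
  exact Finset.prod_le_one (fun i _ => (hIcc i).1) fun i _ => (hIcc i).2

/-- When the Laplace weights `1 / √det` of the minimizers are proportional to `w`, the limit is a
`w`-average. -/
lemma tendsto_laplace_mfEnergy [DecidableEq ι] {y : ι → ℝ} {p : κ → ι → ℝ} {h : (ι → ℝ) → ℝ}
    (hβ : 0 < β) (hy : y ∈ minimizers ι β) (hp : Set.range p = minimizers ι β)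
    (hinj : Function.Injective p) (hC : C ≠ 0) (hw : ∀ i, w i * √(hessian β (p i)).det = C)
    (hc : Continuous h) (hK : ∀ z, |h z| ≤ K) :
    Tendsto (fun n : ℕ => √n ^ Fintype.card ι *
      ∫ z, h z * Real.exp (-(n * (mfEnergy β z - mfEnergy β y)))) atTop
      (𝓝 (gaussConst ι / C * ∑ i, w i * h (p i))) := by
  have hmem : ∀ i, p i ∈ minimizers ι β := fun i => hp ▸ Set.mem_range_self i
  have hdet : ∀ i, √(hessian β (p i)).det ≠ 0 := fun i => right_ne_zero_of_mul ((hw i).symm ▸ hC)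
  have hlevel : ∀ z, mfEnergy β z = mfEnergy β y ↔ ∃ i, p i = z := fun z => by
    rw [← Set.mem_range, hp]
    exact ⟨fun hz x => hz.trans_le (hy x), fun hz => (hz y).antisymm (hy z)⟩
  have hweight : ∀ i, h (p i) * (gaussConst ι / √(hessian β (p i)).det) =
      gaussConst ι / C * (w i * h (p i)) := fun i => by
    have := left_ne_zero_of_mul ((hw i).symm ▸ hC)
    have := hdet i
    rw [← hw i]
    field_simp
  rw [Finset.mul_sum, ← Finset.sum_congr rfl fun i _ => hweight i]
  exact (tendsto_laplace (continuous_mfEnergy β) (tendsto_mfEnergy_cocompact hβ)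
    (integrable_exp_neg_mfEnergy hβ) hy hlevel hinj
    (fun i => hasCriticalHessian_mfEnergy (softmax_eq_of_mem_minimizers hβ (hmem i)))
    (fun i => (posSemidef_hessian hβ (hmem i)).posDef_iff_det_ne_zero.2
      fun hi => hdet i (by rw [hi, Real.sqrt_zero])) hc hK).comp tendsto_natCast_atTop_atTop

lemma tendsto_gibbs_word [NeZero q] {p : κ → Fin q → ℝ} (hβ : 0 < β)
    (hp : Set.range p = minimizers (Fin q) β) (hinj : Function.Injective p) (hsum : 0 < ∑ i, w i)
    (hC : C ≠ 0) (hw : ∀ i, w i * √(hessian β (p i)).det = C) {m : ℕ} (u : Fin m → Fin q) :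
    Tendsto (fun n => gibbs q n β (word m ⁻¹' {u})) atTop
      (𝓝 (ENNReal.ofReal ((∑ i, w i * ∏ j, p i (u j)) / ∑ i, w i))) := by
  obtain ⟨y, hy⟩ := minimizers_nonempty (ι := Fin q) hβ
  have hsoft : ∀ i, softmax (β • p i) = p i := fun i =>
    softmax_eq_of_mem_minimizers hβ (hp ▸ Set.mem_range_self i)
  have hG : gaussConst (Fin q) / C ≠ 0 := div_ne_zero (gaussConst_pos _).ne' hC
  have hnum := tendsto_laplace_mfEnergy hβ hy hp hinj hC hw (continuous_prod_softmax β u)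
    fun z => abs_prod_softmax_le_one (β • z) u
  have hden := tendsto_laplace_mfEnergy hβ hy hp hinj hC hw (continuous_const (y := (1 : ℝ)))
    fun _ => abs_one.le
  simp only [hsoft] at hnum
  simp only [mul_one] at hden
  have hratio := hnum.div hden (mul_ne_zero hG hsum.ne')
  rw [mul_div_mul_left _ _ hG] at hratio
  refine ((ENNReal.continuous_ofReal.tendsto _).comp hratio).congr' ?_
  filter_upwards [eventually_ge_atTop m, eventually_ne_atTop 0] with n hmn hn
  have hsqrt : √(n : ℝ) ≠ 0 := Real.sqrt_ne_zero'.2 (by positivity)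
  rw [gibbs_word_eq_integral hβ hmn hn (mfEnergy β y) u, Function.comp_apply, Pi.div_apply,
    mul_div_mul_left _ _ (pow_ne_zero _ hsqrt)]

theorem weaklyConverges_gibbs [NeZero q] {p : κ → Fin q → ℝ} (hβ : 0 < β)
    (hp : Set.range p = minimizers (Fin q) β) (hinj : Function.Injective p) (hw0 : ∀ i, 0 < w i)
    (hC : C ≠ 0) (hw : ∀ i, w i * √(hessian β (p i)).det = C) :
    WeaklyConverges (fun n => gibbs q n β) (bernoulliMixture w p) := by
  have : Nonempty κ := Set.range_nonempty_iff_nonempty.1 (hp ▸ minimizers_nonempty hβ)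
  have hsum : 0 < ∑ i, w i := Finset.sum_pos (fun i _ => hw0 i) Finset.univ_nonempty
  have hsimplex : ∀ i, p i ∈ stdSimplex ℝ (Fin q) := fun i =>
    softmax_eq_of_mem_minimizers hβ (hp ▸ Set.mem_range_self i) ▸ softmax_mem_stdSimplex _
  refine weaklyConverges_of_word (fun n => isProbabilityMeasure_gibbs n β)
    (isProbabilityMeasure_bernoulliMixture (fun i => (hw0 i).le) hsum hsimplex) fun m u => ?_
  rw [bernoulliMixture_word (fun i => (hw0 i).le) hsum hsimplex]
  exact tendsto_gibbs_word hβ hp hinj hsum hC hw u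

end LaplaceLimit

/-! ### The three phases -/

section Phases

variable {q : ℕ} {β s : ℝ}

lemma eq_bernoulli_of_isDynamicalGibbs [NeZero q] {k : Fin q} {μ : Measure (Shift q)}
    (hs : s ∈ meanFieldRoots q β) (hμ : IsDynamicalGibbs shift (potential k (β * s)) μ) :
    μ = bernoulli (orderPoint k s) := by
  rw [(isDynamicalGibbs_potential k _).2 μ hμ.1, softmax_single, ← mem_meanFieldRoots.1 hs]

lemma eq_uniformBernoulli_of_isDynamicalGibbs [NeZero q] {k : Fin q} {μ : Measure (Shift q)}
    (hμ : IsDynamicalGibbs shift (potential k 0) μ) : μ = uniformBernoulli q := by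
  rw [uniformBernoulli_eq_bernoulli, ← orderPoint_zero k]
  exact eq_bernoulli_of_isDynamicalGibbs (zero_mem_meanFieldRoots q 0) (by rwa [mul_zero])

/-- The eigenvalue in the direction of the order parameter is the smaller one. -/
lemma det_hessian_orderPoint_pos (hq : 2 ≤ q) (hβ : 0 < β) (hs0 : 0 ≤ s) (hs1 : s ≤ 1)
    (h : β * ((1 + ((q : ℝ) - 1) * s) * (1 - s) / q) < 1) (k : Fin q) :
    0 < (hessian β (orderPoint k s)).det := by
  have hr : (2 : ℝ) ≤ q := by exact_mod_cast hq
  have hle : (1 - s) / q ≤ (1 + ((q : ℝ) - 1) * s) * (1 - s) / q := by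
    gcongr
    nlinarith [mul_nonneg (mul_nonneg (by linarith : 0 ≤ (q : ℝ) - 1) hs0) (sub_nonneg.2 hs1)]
  have htransverse : β * ((1 - s) / q) < 1 := (by gcongr : _ ≤ _).trans_lt h
  rw [det_hessian_orderPoint β k s hq]
  exact mul_pos (mul_pos (pow_pos hβ _) (pow_pos (sub_pos.2 htransverse) _)) (sub_pos.2 h)

lemma log_lt_mul_sBeta (hq : 2 < q) (hβ : betaC q ≤ β) :
    Real.log ((q : ℝ) - 1) < β * sBeta q β := by
  rcases hβ.eq_or_lt with rfl | hlt
  · have := log_sub_one_pos hq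
    have := betaC_mul_inflection hq
    rw [sBeta_betaC hq]
    linarith
  · have hβ0 : 0 < β := (betaC_pos hq).trans hlt
    have hgreatest := isGreatest_sBeta (q := q) (by omega) hβ
    have hmin : orderPoint ⟨0, by omega⟩ (sBeta q β) ∈ minimizers (Fin q) β :=
      minimizers_of_betaC_lt hq hlt ▸ ⟨_, rfl⟩
    refine log_lt_of_orderEnergy_neg hq hβ0 hgreatest.1
      (hgreatest.2 (zero_mem_meanFieldRoots q β)) ?_
    exact ((orderPoint_mem_minimizers hq.le hβ0 _).1 hmin _).trans_lt
      (orderEnergy_two_mul_log_div_neg hq hlt)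

lemma sBeta_pos (hq : 2 < q) (hβ : betaC q ≤ β) : 0 < sBeta q β :=
  pos_of_mul_pos_right ((log_sub_one_pos hq).trans (log_lt_mul_sBeta hq hβ))
    ((betaC_pos hq).trans_le hβ).le

lemma det_hessian_orderPoint_sBeta_pos (hq : 2 < q) (hβ : betaC q ≤ β) (k : Fin q) :
    0 < (hessian β (orderPoint k (sBeta q β))).det := by
  have hq1 : (1 : ℝ) ≤ q := by exact_mod_cast (by omega : 1 ≤ q)
  have hβ0 : 0 < β := (betaC_pos hq).trans_le hβ
  have hroot := (isGreatest_sBeta (q := q) (by omega) hβ).1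
  have hs := mem_meanFieldRoots.1 hroot
  have hslope := deriv_magnetization_lt hq hβ hroot (log_lt_mul_sBeta hq hβ)
  rw [(hasDerivAt_magnetization hq1 _).deriv, ← hs] at hslope
  exact det_hessian_orderPoint_pos hq.le hβ0 (sBeta_pos hq hβ).le
    (hs ▸ (magnetization_lt_one hq1 _).le) (by rwa [← lt_inv_mul_iff₀ hβ0, mul_one]) k

lemma one_sub_div_pos (hq : 2 < q) (hβ : β ≤ betaC q) : 0 < 1 - β / q := by
  have hq0 : (0 : ℝ) < q := by exact_mod_cast zero_lt_two.trans hq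
  exact sub_pos.2 ((div_lt_one hq0).2 (hβ.trans_lt (betaC_lt hq)))

lemma det_hessian_uniform (hq : 2 < q) (β : ℝ) : (hessian β fun _ : Fin q => 1 / (q : ℝ)).det =
    β ^ q * (1 - β / q) ^ (q - 2) * (1 - β / q) := by
  have := det_hessian_orderPoint β ⟨0, by omega⟩ 0 hq.le
  rw [orderPoint_zero] at this
  rw [this]
  ring

lemma det_hessian_uniform_pos (hq : 2 < q) (hβ : 0 < β) (hle : β ≤ betaC q) :
    0 < (hessian β fun _ : Fin q => 1 / (q : ℝ)).det := by
  have hstab := one_sub_div_pos hq hle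
  rw [det_hessian_uniform hq]
  positivity

lemma weaklyConverges_of_lt_betaC (hq : 2 < q) (hβ : 0 < β) (hlt : β < betaC q) :
    WeaklyConverges (fun n => gibbs q n β) (uniformBernoulli q) := by
  have : NeZero q := ⟨by omega⟩
  have hdet := det_hessian_uniform_pos hq hβ hlt.le
  have h := weaklyConverges_gibbs (w := fun _ : Unit => 1) (p := fun _ _ => 1 / (q : ℝ)) hβ
    (by rw [Set.range_const, minimizers_of_lt_betaC hq hβ hlt])
    (Function.injective_of_subsingleton _) (fun _ => one_pos) (Real.sqrt_pos.2 hdet).ne'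
    fun _ => one_mul _
  rwa [bernoulliMixture_const_one, Fintype.card_unit, Nat.cast_one, inv_one, one_smul,
    Fintype.sum_unique, ← uniformBernoulli_eq_bernoulli] at h

lemma weaklyConverges_of_betaC_lt (hq : 2 < q) (hlt : betaC q < β) :
    WeaklyConverges (fun n => gibbs q n β)
      ((q : ℝ≥0∞)⁻¹ • ∑ k, bernoulli (orderPoint k (sBeta q β))) := by
  have : NeZero q := ⟨by omega⟩
  have hdet := det_hessian_orderPoint_sBeta_pos hq hlt.le 0
  have h := weaklyConverges_gibbs (w := fun _ : Fin q => 1) ((betaC_pos hq).trans hlt)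
    (minimizers_of_betaC_lt hq hlt).symm (orderPoint_injective (sBeta_pos hq hlt.le).ne')
    (fun _ => one_pos) (Real.sqrt_pos.2 hdet).ne' fun k => by
      rw [one_mul, det_hessian_orderPoint _ _ _ hq.le, det_hessian_orderPoint _ _ _ hq.le]
  rwa [bernoulliMixture_const_one, Fintype.card_fin] at h

lemma det_hessian_orderPoint_betaC (hq : 2 < q) (k : Fin q) :
    (hessian (betaC q) (orderPoint k (sBeta q (betaC q)))).det =
      betaC q ^ q * (1 - betaC q / (q * ((q : ℝ) - 1))) ^ (q - 2) * (1 - betaC q / q) := by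
  have hr : (2 : ℝ) < q := by exact_mod_cast hq
  have hq1 : (q : ℝ) - 1 ≠ 0 := by linarith
  have hsub : 1 - 2 * inflection q = ((q : ℝ) - 1)⁻¹ := by
    rw [inflection]
    field_simp
    ring
  have hadd : 1 + ((q : ℝ) - 1) * (2 * inflection q) = q - 1 := by
    rw [inflection]
    field_simp
    ring
  rw [det_hessian_orderPoint _ _ _ hq.le, sBeta_betaC hq, hadd, hsub, mul_inv_cancel₀ hq1]
  congr 4 <;> field_simp

lemma sqrt_pow_sub_two (hq : 2 ≤ q) {x : ℝ} (hx : 0 ≤ x) :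
    √(x ^ (q - 2)) = x ^ (((q : ℝ) - 2) / 2) := by
  rw [Real.sqrt_eq_rpow, ← Real.rpow_natCast, ← Real.rpow_mul hx, Nat.cast_sub hq, Nat.cast_two,
    mul_one_div]

lemma one_sub_betaC_div_mul_pos (hq : 2 < q) : 0 < 1 - betaC q / (q * ((q : ℝ) - 1)) := by
  have hr : (2 : ℝ) < q := by exact_mod_cast hq
  have hle : betaC q / (q * ((q : ℝ) - 1)) ≤ betaC q / q := by
    gcongr
    · exact (betaC_pos hq).le
    · nlinarith
  linarith [one_sub_div_pos hq le_rfl]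

lemma weightA_pos (hq : 2 < q) : 0 < weightA q :=
  Real.rpow_pos_of_pos (one_sub_betaC_div_mul_pos hq) _

lemma weightB_pos (hq : 2 < q) : 0 < weightB q :=
  Real.rpow_pos_of_pos (one_sub_div_pos hq le_rfl) _

lemma weightB_mul_sqrt_det_eq (hq : 2 < q) (k : Fin q) :
    weightB q * √(hessian (betaC q) (orderPoint k (sBeta q (betaC q)))).det =
      weightA q * √(hessian (betaC q) fun _ : Fin q => 1 / (q : ℝ)).det := by
  have hA := (one_sub_betaC_div_mul_pos hq).le
  have hB := (one_sub_div_pos hq le_rfl).le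
  rw [weightA, weightB, ← sqrt_pow_sub_two hq.le hA, ← sqrt_pow_sub_two hq.le hB,
    ← Real.sqrt_mul (pow_nonneg hB _), ← Real.sqrt_mul (pow_nonneg hA _),
    det_hessian_orderPoint_betaC hq, det_hessian_uniform hq]
  congr 1
  ring

lemma orderPoint_ne_uniform (hq : 1 < q) (k : Fin q) (hs : s ≠ 0) :
    orderPoint k s ≠ fun _ => 1 / (q : ℝ) := fun h => by
  have hr : (1 : ℝ) < q := by exact_mod_cast hq
  have hk := congrFun h k
  rw [orderPoint_apply_self, div_left_inj' (by linarith), add_eq_left] at hk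
  exact mul_ne_zero (by linarith) hs hk

lemma weaklyConverges_betaC (hq : 2 < q) :
    WeaklyConverges (fun n => gibbs q n (betaC q))
      ((ENNReal.ofReal (weightA q + q * weightB q))⁻¹ •
        (ENNReal.ofReal (weightA q) • uniformBernoulli q + ENNReal.ofReal (weightB q) •
          ∑ k, bernoulli (orderPoint k (sBeta q (betaC q))))) := by
  have : NeZero q := ⟨by omega⟩
  have hs := (sBeta_pos hq le_rfl).ne'
  set w : Option (Fin q) → ℝ := fun o => o.elim (weightA q) fun _ => weightB q
  set p : Option (Fin q) → Fin q → ℝ := fun o =>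
    o.elim (fun _ => 1 / (q : ℝ)) fun k => orderPoint k (sBeta q (betaC q))
  have hp : Set.range p = minimizers (Fin q) (betaC q) :=
    (Option.range_elim _ _).trans (minimizers_betaC hq).symm
  have hinj : Function.Injective p := Option.injective_iff.2
    ⟨orderPoint_injective hs, fun ⟨k, hk⟩ => orderPoint_ne_uniform (by omega) k hs hk⟩
  have hw0 : ∀ o, 0 < w o := Option.forall.2 ⟨weightA_pos hq, fun _ => weightB_pos hq⟩
  have hC : weightA q * √(hessian (betaC q) fun _ : Fin q => 1 / (q : ℝ)).det ≠ 0 :=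
    (mul_pos (weightA_pos hq) (Real.sqrt_pos.2
      (det_hessian_uniform_pos hq (betaC_pos hq) le_rfl))).ne'
  have h := weaklyConverges_gibbs (betaC_pos hq) hp hinj hw0 hC
    (Option.forall.2 ⟨rfl, weightB_mul_sqrt_det_eq hq⟩)
  rw [bernoulliMixture, Fintype.sum_option, Fintype.sum_option] at h
  simpa only [w, p, Option.elim_none, Option.elim_some, Finset.sum_const, Finset.card_univ,
    Fintype.card_fin, nsmul_eq_mul, ← Finset.smul_sum, ← uniformBernoulli_eq_bernoulli] using h

end Phases

end CWP

end

theorem theorem1p3 (q : ℕ) (hq : 2 < q) :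
    -- the dynamical Gibbs measures exist (and, by definition, are unique)
    (∀ (k : Fin q) (b : ℝ), ∃ μ : Measure (CWP.Shift q),
      CWP.IsDynamicalGibbs CWP.shift (CWP.potential k b) μ) ∧
    -- `s_β` really is the largest solution
    (∀ β : ℝ, CWP.betaC q ≤ β → IsGreatest (CWP.meanFieldRoots q β) (CWP.sBeta q β)) ∧
    -- the weak limits
    ∀ μt : Fin q → ℝ → Measure (CWP.Shift q),
      (∀ k b, CWP.IsDynamicalGibbs CWP.shift (CWP.potential k b) (μt k b)) →
      ∀ β : ℝ, 0 < β →
        (β < CWP.betaC q →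
          CWP.WeaklyConverges (fun n => CWP.gibbs q n β) (CWP.uniformBernoulli q)) ∧
        (CWP.betaC q < β →
          CWP.WeaklyConverges (fun n => CWP.gibbs q n β)
            ((q : ℝ≥0∞)⁻¹ • ∑ k, μt k (β * CWP.sBeta q β))) ∧
        (β = CWP.betaC q →
          CWP.WeaklyConverges (fun n => CWP.gibbs q n β)
            ((ENNReal.ofReal (CWP.weightA q + q * CWP.weightB q))⁻¹ •
              (ENNReal.ofReal (CWP.weightA q) • μt ⟨0, by omega⟩ 0 +
                ENNReal.ofReal (CWP.weightB q) •
                  ∑ k, μt k (CWP.betaC q * CWP.sBeta q (CWP.betaC q))))) := by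
  have : NeZero q := ⟨by omega⟩
  refine ⟨fun k b => ⟨_, CWP.isDynamicalGibbs_potential k b⟩,
    fun β => CWP.isGreatest_sBeta (by omega), fun μt hμt β hβ => ?_⟩
  have horder : ∀ b, CWP.betaC q ≤ b → ∀ k,
      μt k (b * CWP.sBeta q b) = CWP.bernoulli (CWP.orderPoint k (CWP.sBeta q b)) :=
    fun b hb k => CWP.eq_bernoulli_of_isDynamicalGibbs
      (CWP.isGreatest_sBeta (by omega) hb).1 (hμt k _)
  refine ⟨CWP.weaklyConverges_of_lt_betaC hq hβ, fun hlt => ?_, ?_⟩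
  · simp_rw [horder β hlt.le]
    exact CWP.weaklyConverges_of_betaC_lt hq hlt
  · rintro rfl
    simp_rw [horder _ le_rfl, CWP.eq_uniformBernoulli_of_isDynamicalGibbs (hμt _ 0)]
    exact CWP.weaklyConverges_betaC hq
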